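/- For a family $\mathcal B$ of finite subsets of a cardinal $\kappa$, call $\mathcal B$ \emph{very-large} if every infinite $A\subseteq\kappa$ has an infinite subset $B\subseteq A$ with $[B]^{<\omega}\subseteq\mathcal B$. For an integer $k$, two sets $s,t\in[\kappa]^{<\omega}$ are in \emph{$k$-$\Delta$-position} if $s\cap t=I\cup J$ with $I<J$ (every element of $I$ is below every element of $J$), $|J|\le k$, and $I$ an initial part of both $s$ and $t$. The \emph{positional graph} $\mathfrak G_k(\mathcal B)$ has vertex set $\mathcal B$, two distinct $s,t\in\mathcal B$ being joined by an edge if and only if they are not in $k$-$\Delta$-position. The chromatic number $\chi(\mathfrak G)$ is the least cardinality of a set of colours admitting a colouring of the vertices in which adjacent vertices get different colours. \textbf{Theorem.} Let $n<\omega$. (1) There is a very-large family $\mathcal B_n\subseteq[\omega_n]^{<\omega}$ such that $\chi(\mathfrak G_{2n-1}(\mathcal B_n))=\omega$. (2) Consequently, there are a real Banach space $X$ and a normalized weakly null sequence $(x_\alpha)_{\alpha<\omega_n}$ in $X$ (that is, $\|x_\alpha\|=1$ for all $\alpha$, and for each $f\in X^*$ and $\varepsilon>0$ one has $|f(x_\alpha)|<\varepsilon$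 for all but finitely many $\alpha$) such that for no infinite $A\subseteq\omega_n$ is $(x_\alpha)_{\alpha\in A}$ an unconditional basic sequence. Here $(x_\alpha)_{\alpha\in A}$ is a basic sequence if its norms are bounded and bounded away from $0$ and there is $K\ge1$ with $\|\sum_{\alpha\in A,\,\alpha<\lambda}a_\alpha x_\alpha\|\le K\|\sum_{\alpha\in A}a_\alpha x_\alpha\|$ for all $\lambda\in A$ and all finitely supported real scalars $(a_\alpha)_{\alpha\in A}$, and it is unconditional if moreover there is $K\ge1$ with $\|\sum_{\alpha\in D}a_\alpha x_\alpha\|\le K\|\sum_{\alpha\in A}a_\alpha x_\alpha\|$ for all $D\subseteq A$ and all such scalars. -/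

import Mathlib

open scoped Cardinal Ordinal

universe u

/-- `A < B` for sets: every element of `A` lies below every element of `B`
(vacuously true when one of them is empty). -/
def BlockLT {κ : Type*} [LinearOrder κ] (A B : Finset κ) : Prop :=
  ∀ a ∈ A, ∀ b ∈ B, a < b

/-- `A ⊑ B`: `A` is an initial part of `B`, i.e. `A ⊆ B` and `A < B \ A`. -/
def IsInitialPart {κ : Type*} [LinearOrder κ] (A B : Finset κ) : Prop :=
  A ⊆ B ∧ BlockLT A (B \ A)

/-- `A` and `B` are in `k`-`Δ`-position. The parameter `k` is an integer, so that
`k = -1` (for which no two sets are in position) is meaningful. -/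
def InDeltaPosition {κ : Type*} [LinearOrder κ] (k : ℤ) (A B : Finset κ) : Prop :=
  ∃ I J : Finset κ, BlockLT I J ∧ A ∩ B = I ∪ J ∧ (J.card : ℤ) ≤ k ∧
    IsInitialPart I A ∧ IsInitialPart I B

theorem InDeltaPosition.symm {κ : Type*} [LinearOrder κ] {k : ℤ} {A B : Finset κ}
    (h : InDeltaPosition k A B) : InDeltaPosition k B A := by
  obtain ⟨I, J, h1, h2, h3, h4, h5⟩ := h
  exact ⟨I, J, h1, by rw [Finset.inter_comm, h2], h3, h5, h4⟩

/-- The positional graph `G_k(κ)` on the finite subsets of `κ`: two distinct finite sets are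
joined by an edge when they are not in `k`-`Δ`-position. -/
def positionalGraph (κ : Type*) [LinearOrder κ] (k : ℤ) : SimpleGraph (Finset κ) where
  Adj s t := s ≠ t ∧ ¬ InDeltaPosition k s t
  symm := ⟨fun _ _ h => ⟨h.1.symm, fun h' => h.2 h'.symm⟩⟩
  loopless := ⟨fun _ h => h.1 rfl⟩

/-- The restriction `G_k(𝓑)` of the positional graph to a family `𝓑` of finite sets. -/
def positionalGraphOn {κ : Type*} [LinearOrder κ] (k : ℤ) (𝓑 : Set (Finset κ)) :
    SimpleGraph 𝓑 :=
  (positionalGraph κ k).induce 𝓑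

/-- The chromatic number as a cardinal: the least number of colours of a good colouring. -/
noncomputable def chromaticCardinal {V : Type u} (G : SimpleGraph V) : Cardinal.{u} :=
  sInf {c | ∃ C : Type u, #C = c ∧ Nonempty (G.Coloring C)}

/-- The family over which the chromatic number is minimized is nonempty,
hence the minimum is attained. -/
theorem exists_coloring_chromaticCardinal {V : Type u} (G : SimpleGraph V) :
    ∃ C : Type u, #C = chromaticCardinal G ∧ Nonempty (G.Coloring C) :=
  csInf_mem (s := {c | ∃ C : Type u, #C = c ∧ Nonempty (G.Coloring C)})
    ⟨#V, V, rfl, ⟨G.selfColoring⟩⟩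

/-- A family of finite subsets of `κ` is very-large when every infinite `A ⊆ κ` has an infinite
subset `B` all of whose finite subsets belong to the family. -/
def IsVeryLarge {κ : Type*} (𝓑 : Set (Finset κ)) : Prop :=
  ∀ A : Set κ, A.Infinite → ∃ B ⊆ A, B.Infinite ∧ ∀ s : Finset κ, (s : Set κ) ⊆ B → s ∈ 𝓑

/-- A transfinite sequence is weakly null when, for each functional `f`, all but finitely many
of its terms satisfy `|f (x α)| < ε`, for each `ε > 0`. -/
def IsWeaklyNull {ι X : Type*} [NormedAddCommGroup X] [NormedSpace ℝ X] (x : ι → X) : Prop :=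
  ∀ f : X →L[ℝ] ℝ, Filter.Tendsto (fun α => f (x α)) Filter.cofinite (nhds 0)

/-- A seminormalized (Schauder) basic sequence, indexed by a well-ordered set. -/
def IsBasicSequence {ι X : Type*} [LinearOrder ι] [NormedAddCommGroup X] [NormedSpace ℝ X]
    (x : ι → X) : Prop :=
  (∃ c C : ℝ, 0 < c ∧ ∀ i, c ≤ ‖x i‖ ∧ ‖x i‖ ≤ C) ∧
  ∃ K : ℝ, 1 ≤ K ∧ ∀ (i : ι) (s : Finset ι) (a : ι → ℝ),
    ‖∑ j ∈ s with j < i, a j • x j‖ ≤ K * ‖∑ j ∈ s, a j • x j‖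

/-- A (suppression) unconditional basic sequence. -/
def IsUnconditionalBasicSequence {ι X : Type*} [LinearOrder ι] [NormedAddCommGroup X]
    [NormedSpace ℝ X] (x : ι → X) : Prop :=
  IsBasicSequence x ∧
  ∃ K : ℝ, 1 ≤ K ∧ ∀ (s t : Finset ι) (a : ι → ℝ), t ⊆ s →
    ‖∑ j ∈ t, a j • x j‖ ≤ K * ‖∑ j ∈ s, a j • x j‖

/-! For every ordinal `γ` fix an injection `e γ` of `γ` into its cardinal. In an increasing tuple
`(u 0, …, u n)` below `ω_n`, replace each consecutive pair `α < β` by `e β α`, and repeat. Each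
round shortens the tuple by one entry and lowers the bound by one aleph, so as long as the
intermediate tuples increase, `n` rounds end in a natural number (`reduce_lt_omega`), which together
with the tail determines `u 0` (`head_eq_of_reduce_eq`). By Ramsey's theorem every infinite set has
an infinite subset on which the intermediate tuples increase (`exists_reduceIncreasing_subsequence`)
and the number alone determines `u 0` (`exists_subsequence_determining_head`). Hence
`reductionFamily` is very-large.

Colour `s` by its size and the numbers attached to its tuples of positions. If `s` and `t` share a
colour, the head of each `(n + 1)`-tuple of `s ∩ t` has the same position in both sets, so only the
last `n` common elements can shift. Take the last `2n` common elements: the first `n` of them do not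
shift, and serve as a common tail for any earlier position, so `s` and `t` coincide up to the first
of the `2n` elements. At most `2n - 1` common elements lie beyond it
(`inDeltaPosition_of_reductionColor_eq`).

For the Banach space, this colouring drives a Maurey–Rosenthal coding. The size of each block of a
special sequence codes the colour of the union of the earlier blocks and their sizes. Two special
sequences then agree up to some index, meet in boundedly many points per block up to their last
common code, and are almost orthogonal afterwards. So alternating sums of `m` blocks stay bounded,
while sums with constant sign have norm at least `m` (`IsSpecial.abs_alternating_pairing_le`,
`IsSpecial.le_sum_mul_self`). -/

/-! ### Ramsey's theorem and functions that determine their first variable. -/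

/-- The sequence `x, u 0, u 1, …`. -/
def consSeq {α : Type*} (x : α) (u : ℕ → α) : ℕ → α
  | 0 => x
  | k + 1 => u k

/-- Infinite Ramsey theorem for colourings of increasing `m`-tuples of natural numbers,
presented as predicates on sequences depending only on the first `m` terms. -/
theorem exists_homogeneous_subsequence (m : ℕ) : ∀ (P : (ℕ → ℕ) → Prop),
    (∀ u v, (∀ i < m, u i = v i) → (P u ↔ P v)) →
    ∃ φ : ℕ → ℕ, StrictMono φ ∧
      ((∀ u, StrictMono u → P (φ ∘ u)) ∨ ∀ u, StrictMono u → ¬ P (φ ∘ u)) := by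
  induction m with
  | zero =>
    intro P hP
    refine ⟨id, strictMono_id, ?_⟩
    by_cases h : P id
    · exact Or.inl fun u _ => (hP _ _ (by simp)).1 h
    · exact Or.inr fun u _ h' => h ((hP _ _ (by simp)).1 h')
  | succ m ih =>
    intro P hP
    -- Thin the tail of `ψ` so that, on tuples with head `ψ 0`, the predicate has a constant truth
    -- value `c`. Iterating and keeping the heads leaves a colouring of single indices.
    have step : ∀ ψ : {ψ : ℕ → ℕ // StrictMono ψ}, ∃ (ψ' : {ψ : ℕ → ℕ // StrictMono ψ}) (c : Prop),
        (∃ χ : ℕ → ℕ, StrictMono χ ∧ ψ'.1 = ψ.1 ∘ Nat.succ ∘ χ) ∧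
        ∀ v, StrictMono v → (P (consSeq (ψ.1 0) (ψ'.1 ∘ v)) ↔ c) := by
      rintro ⟨ψ, hψ⟩
      obtain ⟨χ, hχ, h⟩ := ih (fun v => P (consSeq (ψ 0) (ψ ∘ Nat.succ ∘ v))) (by
        intro u v huv
        apply hP
        rintro (_ | i) hi
        · rfl
        · simp [consSeq, huv i (by omega)])
      refine ⟨⟨ψ ∘ Nat.succ ∘ χ, hψ.comp ((strictMono_nat_of_lt_succ (by simp)).comp hχ)⟩, ?_⟩
      rcases h with h | h
      · exact ⟨True, ⟨χ, hχ, rfl⟩, fun v hv => iff_true_intro (h v hv)⟩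
      · exact ⟨False, ⟨χ, hχ, rfl⟩, fun v hv => iff_false_intro (h v hv)⟩
    choose nxt col hnxt hcol using step
    let Ψ : ℕ → {ψ : ℕ → ℕ // StrictMono ψ} := fun k => nxt^[k] ⟨id, strictMono_id⟩
    have hΨs : ∀ k, Ψ (k + 1) = nxt (Ψ k) := fun k => Function.iterate_succ_apply' _ _ _
    have hfac : ∀ k d, ∃ θ : ℕ → ℕ, (Ψ (k + d)).1 = (Ψ k).1 ∘ θ := by
      intro k d
      induction d with
      | zero => exact ⟨id, rfl⟩
      | succ d ihd =>
        obtain ⟨θ, hθ⟩ := ihd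
        obtain ⟨χ, -, h⟩ := hnxt (Ψ (k + d))
        exact ⟨θ ∘ Nat.succ ∘ χ, by rw [← add_assoc, hΨs, h, hθ]; rfl⟩
    let a : ℕ → ℕ := fun k => (Ψ k).1 0
    have ha : StrictMono a := by
      refine strictMono_nat_of_lt_succ fun k => ?_
      obtain ⟨χ, -, h⟩ := hnxt (Ψ k)
      change (Ψ k).1 0 < (Ψ (k + 1)).1 0
      rw [hΨs, h]
      exact (Ψ k).2 (Nat.succ_pos _)
    have key : ∀ u, StrictMono u → (P (a ∘ u) ↔ col (Ψ (u 0))) := by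
      intro u hu
      have : ∀ k, ∃ j, a (u (k + 1)) = (Ψ (u 0 + 1)).1 j := by
        intro k
        have hlt : u 0 < u (k + 1) := hu (Nat.succ_pos k)
        obtain ⟨θ, hθ⟩ := hfac (u 0 + 1) (u (k + 1) - (u 0 + 1))
        rw [Nat.add_sub_cancel' hlt] at hθ
        exact ⟨θ 0, by change (Ψ (u (k + 1))).1 0 = _; rw [hθ]; rfl⟩
      choose v hv using this
      have hvm : StrictMono v := by
        refine strictMono_nat_of_lt_succ fun k => ?_
        rw [← (Ψ (u 0 + 1)).2.lt_iff_lt, ← hv, ← hv]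
        exact ha (hu (Nat.lt_succ_self _))
      rw [← hcol _ v hvm, ← hΨs]
      have : a ∘ u = consSeq ((Ψ (u 0)).1 0) ((Ψ (u 0 + 1)).1 ∘ v) := by
        funext k
        rcases k with _ | k
        · rfl
        · exact hv k
      rw [this]
    by_cases h : ∃ᶠ k in Filter.atTop, col (Ψ k)
    · obtain ⟨θ, hθ, h⟩ := Filter.extraction_of_frequently_atTop h
      exact ⟨a ∘ θ, ha.comp hθ, Or.inl fun u hu => (key (θ ∘ u) (hθ.comp hu)).2 (h _)⟩
    · obtain ⟨θ, hθ, h⟩ := Filter.extraction_of_eventually_atTop (Filter.not_frequently.1 h)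
      exact ⟨a ∘ θ, ha.comp hθ, Or.inr fun u hu h' => h _ ((key (θ ∘ u) (hθ.comp hu)).1 h')⟩

/-- Extension of a finite tuple of numbers below `N` to a sequence. -/
def extendTuple {n N : ℕ} (p : Fin (n + 1) → Fin N) (i : ℕ) : ℕ :=
  if h : i < n + 1 then p ⟨i, h⟩ else N + i

theorem extendTuple_strictMono {n N : ℕ} {p : Fin (n + 1) → Fin N} (hp : StrictMono p) :
    StrictMono (extendTuple p) := by
  intro i j hij
  unfold extendTuple
  split_ifs with h1 h2 h2
  · exact hp (by simpa using hij)
  · have := (p ⟨i, h1⟩).2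
    omega
  · omega
  · omega

theorem extendTuple_of_le {n N : ℕ} (p : Fin (n + 1) → Fin N) {i : ℕ} (h : i ≤ n) :
    extendTuple p i = p ⟨i, by omega⟩ := dif_pos (by omega)

/-- Two increasing sequences factor, on their first `n + 1` terms, through a common increasing
sequence and positions below `2 * n + 2`. -/
theorem exists_common_enumeration (n : ℕ) {u v : ℕ → ℕ} (hu : StrictMono u) (hv : StrictMono v)
    (h0 : u 0 < v 0) : ∃ w : ℕ → ℕ, StrictMono w ∧ ∃ p q : Fin (n + 1) → Fin (2 * n + 2),
      StrictMono p ∧ StrictMono q ∧ (p 0 : ℕ) = 0 ∧ 0 < (q 0 : ℕ) ∧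
      (∀ i ≤ n, w (extendTuple p i) = u i) ∧ ∀ i ≤ n, w (extendTuple q i) = v i := by
  classical
  let S : Finset ℕ := (Finset.range (n + 1)).image u ∪ (Finset.range (n + 1)).image v
  -- The points beyond `u n + v n` make `T` infinite, so that `Nat.nth T` is strictly increasing;
  -- `S` stays initial in `T`, which bounds its positions by its size.
  let T : ℕ → Prop := fun x => x ∈ S ∨ u n + v n < x
  have hSle : ∀ x ∈ S, x ≤ u n + v n := by
    intro x hx
    simp only [S, Finset.mem_union, Finset.mem_image, Finset.mem_range] at hx
    rcases hx with ⟨i, hi, rfl⟩ | ⟨i, hi, rfl⟩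
    · exact (hu.monotone (by omega : i ≤ n)).trans (by omega)
    · exact (hv.monotone (by omega : i ≤ n)).trans (by omega)
  have hScard : S.card ≤ 2 * n + 2 := by
    refine (Finset.card_union_le _ _).trans ?_
    have h1 := Finset.card_image_le (s := Finset.range (n + 1)) (f := u)
    have h2 := Finset.card_image_le (s := Finset.range (n + 1)) (f := v)
    simp only [Finset.card_range] at h1 h2
    omega
  have hTinf : {x | T x}.Infinite :=
    (Set.Ioi_infinite (u n + v n)).mono fun x hx => Or.inr hx
  have hcount : ∀ x ∈ S, Nat.count T x < 2 * n + 2 := by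
    intro x hx
    rw [Nat.count_eq_card_filter_range]
    refine (Finset.card_le_card (t := S.erase x) fun y hy => ?_).trans_lt
      ((Finset.card_erase_lt_of_mem hx).trans_le hScard)
    simp only [Finset.mem_filter, Finset.mem_range, T] at hy
    rw [Finset.mem_erase]
    refine ⟨hy.1.ne, hy.2.resolve_right ?_⟩
    have := hSle x hx
    omega
  have hus : ∀ i, i < n + 1 → u i ∈ S := fun i hi =>
    Finset.mem_union_left _ (Finset.mem_image_of_mem u (Finset.mem_range.2 hi))
  have hvs : ∀ i, i < n + 1 → v i ∈ S := fun i hi =>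
    Finset.mem_union_right _ (Finset.mem_image_of_mem v (Finset.mem_range.2 hi))
  have hmin : ∀ x ∈ S, u 0 ≤ x := by
    intro x hx
    simp only [S, Finset.mem_union, Finset.mem_image, Finset.mem_range] at hx
    rcases hx with ⟨i, hi, rfl⟩ | ⟨i, hi, rfl⟩
    · exact hu.monotone (Nat.zero_le i)
    · exact h0.le.trans (hv.monotone (Nat.zero_le i))
  have hp0 : Nat.count T (u 0) = 0 := by
    rw [Nat.count_eq_card_filter_range, Finset.card_eq_zero, Finset.filter_eq_empty_iff]
    intro x hx hT
    rw [Finset.mem_range] at hx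
    rcases hT with hT | hT
    · exact absurd (hmin x hT) (by omega)
    · have := hu.monotone (Nat.zero_le n)
      omega
  refine ⟨Nat.nth T, Nat.nth_strictMono hTinf,
    fun i => ⟨Nat.count T (u i), hcount _ (hus i i.2)⟩,
    fun i => ⟨Nat.count T (v i), hcount _ (hvs i i.2)⟩, ?_, ?_, hp0, ?_, ?_, ?_⟩
  · intro i j hij
    exact Nat.count_strict_mono (Or.inl (hus i i.2)) (hu hij)
  · intro i j hij
    exact Nat.count_strict_mono (Or.inl (hvs i i.2)) (hv hij)
  · have := Nat.count_strict_mono (p := T) (Or.inl (hus 0 (by omega))) h0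
    exact (Nat.zero_le _).trans_lt this
  · intro i hi
    rw [extendTuple_of_le _ hi]
    exact Nat.nth_count (Or.inl (hus i (by omega)))
  · intro i hi
    rw [extendTuple_of_le _ hi]
    exact Nat.nth_count (Or.inl (hvs i (by omega)))

/-- A function of `n + 1` variables which is injective in the first one is, on some subsequence,
determining the first variable. -/
theorem exists_subsequence_determining_head {β : Type*} (n : ℕ) (G : (ℕ → ℕ) → β)
    (hG : ∀ u v, (∀ i ≤ n, u i = v i) → G u = G v)
    (hinj : ∀ u v, StrictMono u → StrictMono v → (∀ i, u (i + 1) = v (i + 1)) →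
      G u = G v → u 0 = v 0) :
    ∃ φ : ℕ → ℕ, StrictMono φ ∧ ∀ u v, StrictMono u → StrictMono v →
      G (φ ∘ u) = G (φ ∘ v) → u 0 = v 0 := by
  -- A pattern places two tuples inside one increasing `(2 * n + 2)`-tuple, the first using position
  -- `0` and the second avoiding it. A coincidence of `G` along a pattern thus concerns a single
  -- tuple, and Ramsey's theorem applies.
  let Pat := (Fin (n + 1) → Fin (2 * n + 2)) × (Fin (n + 1) → Fin (2 * n + 2))
  let R : Pat → (ℕ → ℕ) → Prop := fun pq w =>
    StrictMono pq.1 ∧ StrictMono pq.2 ∧ (pq.1 0 : ℕ) = 0 ∧ 0 < (pq.2 0 : ℕ) ∧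
      G (w ∘ extendTuple pq.1) = G (w ∘ extendTuple pq.2)
  have hcongr : ∀ (p : Fin (n + 1) → Fin (2 * n + 2)) (w w' : ℕ → ℕ),
      (∀ i < 2 * n + 2, w i = w' i) → G (w ∘ extendTuple p) = G (w' ∘ extendTuple p) := by
    intro p w w' h
    apply hG
    intro i hi
    simp only [Function.comp_apply, extendTuple_of_le p hi]
    exact h _ (p _).2
  obtain ⟨φ, hφ, h⟩ := exists_homogeneous_subsequence (2 * n + 2) (fun w => ∃ pq, R pq w) (by
    intro w w' h
    refine exists_congr fun pq => ?_
    simp only [R, hcongr _ _ _ h])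
  refine ⟨φ, hφ, ?_⟩
  rcases h with h | h
  · exfalso
    -- There are more heads than patterns, so two sequences that differ only in their heads `x ≠ y`
    -- use the same pattern. Its second tuple does not see the head, hence `G` agrees on the two
    -- first tuples, against `hinj`.
    let M := Fintype.card Pat + 1
    let us : ℕ → ℕ → ℕ := fun x => consSeq x fun k => M + k
    have hus : ∀ x, x < M → StrictMono (us x) := by
      intro x hx
      refine strictMono_nat_of_lt_succ fun k => ?_
      rcases k with _ | k
      · change x < M + 0
        omega
      · change M + k < M + (k + 1)
        omega
    choose pq hpq using fun x : Fin M => h (us x) (hus x x.2)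
    obtain ⟨x, y, hxy, hp⟩ := Fintype.exists_ne_map_eq_of_card_lt pq (by simp [M])
    obtain ⟨hp1, hp2, hp3, hp4, hp5⟩ := hpq x
    have hq5 := (hpq y).2.2.2.2
    rw [← hp] at hq5
    have htail : ∀ j, 0 < j → us x j = us y j := by
      rintro (_ | j) hj
      · omega
      · rfl
    have hm := extendTuple_strictMono hp1
    have heq : (φ ∘ us x) ∘ extendTuple (pq x).2 = (φ ∘ us y) ∘ extendTuple (pq x).2 := by
      funext i
      simp only [Function.comp_apply]
      rw [htail]
      have h1 := (extendTuple_strictMono hp2).monotone (Nat.zero_le i)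
      rw [extendTuple_of_le _ (Nat.zero_le n)] at h1
      exact lt_of_lt_of_le hp4 h1
    rw [heq, ← hq5] at hp5
    have := hinj _ _ ((hφ.comp (hus x x.2)).comp hm) ((hφ.comp (hus y y.2)).comp hm) (by
      intro i
      simp only [Function.comp_apply]
      rw [htail]
      exact (Nat.zero_le _).trans_lt (hm (Nat.succ_pos i))) hp5
    have h0 : extendTuple (pq x).1 0 = 0 := by
      rw [extendTuple_of_le _ (Nat.zero_le n)]
      exact hp3
    simp only [Function.comp_apply, h0] at this
    exact hxy (Fin.ext (hφ.injective this))
  · have key : ∀ u v, StrictMono u → StrictMono v → u 0 < v 0 → G (φ ∘ u) ≠ G (φ ∘ v) := by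
      intro u v hu hv h0 he
      obtain ⟨w, hw, p, q, h1, h2, h3, h4, h5, h6⟩ := exists_common_enumeration n hu hv h0
      refine h w hw ⟨(p, q), h1, h2, h3, h4, ?_⟩
      exact (hG _ (φ ∘ u) fun i hi => congrArg φ (h5 i hi)).trans
        (he.trans (hG (φ ∘ v) _ fun i hi => (congrArg φ (h6 i hi)).symm))
    intro u v hu hv he
    rcases lt_trichotomy (u 0) (v 0) with h0 | h0 | h0
    · exact absurd he (key u v hu hv h0)
    · exact h0
    · exact absurd he.symm (key v u hv hu h0)

/-! ### Reducing tuples of ordinals below `ω_n` to natural numbers. -/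

/-- The iterated reduction of a tuple by a family of maps `e γ`. -/
def reduce {O : Type*} (e : O → O → O) : ℕ → (ℕ → O) → O
  | 0, u => u 0
  | j + 1, u => e (reduce e j (u ∘ Nat.succ)) (reduce e j u)

section reduce

variable {O : Type*} (e : O → O → O)

theorem reduce_congr (j : ℕ) : ∀ {u v : ℕ → O}, (∀ i ≤ j, u i = v i) →
    reduce e j u = reduce e j v := by
  induction j with
  | zero => exact fun h => h 0 le_rfl
  | succ j ih =>
    intro u v h
    simp only [reduce]
    rw [ih (u := u) (v := v) fun i hi => h i (by omega),
      ih (u := u ∘ Nat.succ) (v := v ∘ Nat.succ) fun i hi => h (i + 1) (by omega)]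

variable [LinearOrder O]

/-- All reductions of order below `n` increase when the tuple is shifted. -/
def ReduceIncreasing (n : ℕ) (u : ℕ → O) : Prop :=
  ∀ i < n, reduce e i u < reduce e i (u ∘ Nat.succ)

theorem ReduceIncreasing.congr {e : O → O → O} {n : ℕ} {u v : ℕ → O}
    (hu : ReduceIncreasing e n u) (h : ∀ i ≤ n, u i = v i) : ReduceIncreasing e n v := by
  intro i hi
  rw [← reduce_congr e i (u := u) (v := v) fun k hk => h k (by omega),
    ← reduce_congr e i (u := u ∘ Nat.succ) (v := v ∘ Nat.succ) fun k hk => h (k + 1) (by omega)]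
  exact hu i hi

variable {e}

/-- The outermost index `γ` depends only on the tail, so it is common to both sides;
`ReduceIncreasing` puts both arguments below `γ`, where `e γ` is injective and can be cancelled. -/
theorem head_eq_of_reduce_eq (he : ∀ γ, Set.InjOn (e γ) (Set.Iio γ)) (j : ℕ) {u v : ℕ → O}
    (hu : ReduceIncreasing e j u) (hv : ReduceIncreasing e j v)
    (htail : ∀ i < j, u (i + 1) = v (i + 1)) (h : reduce e j u = reduce e j v) : u 0 = v 0 := by
  induction j with
  | zero => exact h
  | succ j ih =>
    have hs : reduce e j (u ∘ Nat.succ) = reduce e j (v ∘ Nat.succ) :=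
      reduce_congr e j fun i hi => htail i (by omega)
    refine ih (fun i hi => hu i (by omega)) (fun i hi => hv i (by omega))
      (fun i hi => htail i (by omega)) ?_
    simp only [reduce] at h
    rw [hs] at h
    refine he _ ?_ ?_ h
    · rw [← hs]
      exact hu j (by omega)
    · exact hv j (by omega)

/-- By Ramsey's theorem a reduction and its shift compare in one way throughout: equality
contradicts injectivity in the head, and a decrease contradicts well-foundedness. -/
theorem exists_reduceIncreasing_subsequence [WellFoundedLT O]
    (he : ∀ γ, Set.InjOn (e γ) (Set.Iio γ)) {b : ℕ → O} (hb : StrictMono b) (n : ℕ) :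
    ∃ φ : ℕ → ℕ, StrictMono φ ∧ ∀ u, StrictMono u → ReduceIncreasing e n (b ∘ φ ∘ u) := by
  induction n with
  | zero => exact ⟨id, strictMono_id, fun u _ i hi => absurd hi (by omega)⟩
  | succ n ih =>
    obtain ⟨φ, hφ, hinc⟩ := ih
    have hdep : ∀ u v : ℕ → ℕ, (∀ i < n + 2, u i = v i) →
        reduce e n (b ∘ φ ∘ u) = reduce e n (b ∘ φ ∘ v) ∧
        reduce e n (b ∘ φ ∘ u ∘ Nat.succ) = reduce e n (b ∘ φ ∘ v ∘ Nat.succ) := by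
      intro u v h
      exact ⟨reduce_congr e n fun i hi => by simp [h i (by omega)],
        reduce_congr e n fun i hi => by simp [h (i + 1) (by omega)]⟩
    obtain ⟨ψ, hψ, h⟩ := exists_homogeneous_subsequence (n + 2)
      (fun u => reduce e n (b ∘ φ ∘ u) < reduce e n (b ∘ φ ∘ u ∘ Nat.succ)) (by
        intro u v h
        rw [(hdep u v h).1, (hdep u v h).2])
    obtain ⟨χ, hχ, h'⟩ := exists_homogeneous_subsequence (n + 2)
      (fun u => reduce e n (b ∘ φ ∘ ψ ∘ u) = reduce e n (b ∘ φ ∘ ψ ∘ u ∘ Nat.succ)) (by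
        intro u v h
        have := hdep (ψ ∘ u) (ψ ∘ v) fun i hi => congrArg ψ (h i hi)
        exact ⟨fun hh => this.1.symm.trans (hh.trans this.2),
          fun hh => this.1.trans (hh.trans this.2.symm)⟩)
    rcases h with h | h
    · refine ⟨φ ∘ ψ, hφ.comp hψ, fun u hu i hi => ?_⟩
      rcases Nat.lt_succ_iff_lt_or_eq.1 hi with hi | rfl
      · exact hinc (ψ ∘ u) (hψ.comp hu) i hi
      · exact h u hu
    exfalso
    rcases h' with h' | h'
    -- The tuples `0, 2, 3, …` and `1, 2, 3, …` have the same shift, so both reductions would equal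
    -- the reduction of that shift.
    · let us : ℕ → ℕ → ℕ := fun x => consSeq x fun k => 2 + k
      have hus : ∀ x < 2, StrictMono (us x) := by
        intro x hx
        refine strictMono_nat_of_lt_succ fun k => ?_
        rcases k with _ | k
        · change x < 2 + 0
          omega
        · change 2 + k < 2 + (k + 1)
          omega
      have h0 := h' (us 0) (hus 0 (by omega))
      have h1 := h' (us 1) (hus 1 (by omega))
      have := head_eq_of_reduce_eq he n
        (hinc (ψ ∘ χ ∘ us 0) (hψ.comp (hχ.comp (hus 0 (by omega)))))
        (hinc (ψ ∘ χ ∘ us 1) (hψ.comp (hχ.comp (hus 1 (by omega)))))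
        (fun i _ => rfl) (h0.trans h1.symm)
      have := ((hb.comp hφ).comp (hψ.comp hχ)).injective this
      exact absurd this (by decide)
    · have hmono : ∀ k, StrictMono fun i : ℕ => i + k := fun k i j hij => Nat.add_lt_add_right hij k
      have hdec : ∀ k, reduce e n (b ∘ φ ∘ ψ ∘ χ ∘ fun i => i + (k + 1)) <
          reduce e n (b ∘ φ ∘ ψ ∘ χ ∘ fun i => i + k) := by
        intro k
        have h1 := h (χ ∘ fun i => i + k) (hχ.comp (hmono k))
        have h2 := h' (fun i => i + k) (hmono k)
        have h3 : (fun i : ℕ => i + (k + 1)) = (fun i => i + k) ∘ Nat.succ := by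
          funext i
          simp only [Function.comp_apply]
          omega
        rw [h3]
        exact lt_of_le_of_ne (not_lt.1 h1) (Ne.symm h2)
      exact not_strictAnti_of_wellFoundedLT
        (fun k => reduce e n (b ∘ φ ∘ ψ ∘ χ ∘ fun i => i + k)) (strictAnti_nat_of_succ_lt hdec)

end reduce

theorem exists_initial_injections : ∃ e : Ordinal.{0} → Ordinal.{0} → Ordinal.{0},
    (∀ γ, Set.InjOn (e γ) (Set.Iio γ)) ∧ ∀ γ, ∀ α < γ, e γ α < γ.card.ord := by
  have : ∀ γ : Ordinal.{0}, ∃ f : Ordinal.{0} → Ordinal.{0},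
      Set.InjOn f (Set.Iio γ) ∧ ∀ α < γ, f α < γ.card.ord := by
    intro γ
    have h : #(Set.Iio γ) = #(Set.Iio γ.card.ord) := by
      rw [Cardinal.mk_Iio_ordinal, Cardinal.mk_Iio_ordinal, Cardinal.card_ord]
    obtain ⟨g⟩ := Cardinal.eq.1 h
    classical
    refine ⟨fun α => if h : α < γ then (g ⟨α, h⟩ : Ordinal) else 0, ?_, ?_⟩
    · intro x hx y hy hxy
      rw [Set.mem_Iio] at hx hy
      simp only [hx, hy, dif_pos] at hxy
      exact congrArg Subtype.val (g.injective (Subtype.ext hxy))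
    · intro α hα
      simp only [hα, dif_pos]
      exact (g ⟨α, hα⟩).2
  choose e he using this
  exact ⟨e, fun γ => (he γ).1, fun γ => (he γ).2⟩

/-- One round trades `ω_ (m + 1)` for `ω_ m`, because an ordinal below `ω_ (m + 1)` has cardinality
at most `ℵ_ m`. -/
theorem reduce_lt_omega {e : Ordinal.{0} → Ordinal.{0} → Ordinal.{0}}
    (he : ∀ γ, ∀ α < γ, e γ α < γ.card.ord) {n : ℕ} {a : ℕ → Ordinal.{0}}
    (ha : ∀ i, a i < ω_ n) (hinc : ∀ u, StrictMono u → ReduceIncreasing e n (a ∘ u))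
    (j : ℕ) : ∀ (m : ℕ), j + m = n → ∀ u, StrictMono u → reduce e j (a ∘ u) < ω_ m := by
  induction j with
  | zero =>
    intro m hm u _
    obtain rfl : m = n := by omega
    exact ha _
  | succ j ih =>
    intro m hm u hu
    have hs : StrictMono (u ∘ Nat.succ) := hu.comp (strictMono_nat_of_lt_succ (by simp))
    have h1 := ih (m + 1) (by omega) _ hs
    have h2 : reduce e j (a ∘ u) < reduce e j (a ∘ u ∘ Nat.succ) := hinc u hu j (by omega)
    refine (he _ _ h2).trans_le ?_
    rw [← Cardinal.ord_aleph, Cardinal.ord_le_ord, ← Order.lt_succ_iff, Cardinal.succ_aleph,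
      ← Cardinal.lt_ord, Cardinal.ord_aleph]
    exact_mod_cast h1

theorem exists_strictMono_mem_of_infinite {κ : Type*} [LinearOrder κ] [WellFoundedLT κ] {A : Set κ}
    (hA : A.Infinite) : ∃ a : ℕ → κ, StrictMono a ∧ ∀ i, a i ∈ A := by
  have := hA.to_subtype
  let f := Infinite.natEmbedding A
  obtain ⟨g, h⟩ := exists_increasing_or_nonincreasing_subseq (· < ·) fun i => (f i : κ)
  rcases h with h | h
  · exact ⟨fun i => f (g i), fun i j hij => h i j hij, fun i => (f (g i)).2⟩
  · refine absurd (fun i j hij => ?_)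
      (not_strictAnti_of_wellFoundedLT fun i => (f (g i) : κ))
    refine lt_of_le_of_ne (not_lt.1 (h i j hij)) fun he => ?_
    exact hij.ne' (g.injective (f.injective (Subtype.ext he)))

/-! ### Tuples and positions in finite sets. -/

section enumeration

variable {κ : Type*} [LinearOrder κ]

/-- `u 0 < … < u n` are elements of `s`. -/
def TupleIn (n : ℕ) (s : Finset κ) (u : ℕ → κ) : Prop :=
  StrictMonoOn u (Set.Iic n) ∧ ∀ i ≤ n, u i ∈ s

theorem TupleIn.exists_strictMono_index {n : ℕ} {s : Finset κ} {u a : ℕ → κ} (hu : TupleIn n s u)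
    (ha : StrictMono a) (hs : (s : Set κ) ⊆ Set.range a) :
    ∃ w : ℕ → ℕ, StrictMono w ∧ ∀ i ≤ n, a (w i) = u i := by
  have : ∀ i, ∃ k, i ≤ n → a k = u i := by
    intro i
    by_cases h : i ≤ n
    · obtain ⟨k, hk⟩ := hs (hu.2 i h)
      exact ⟨k, fun _ => hk⟩
    · exact ⟨0, fun h' => absurd h' h⟩
  choose w hw using this
  have hlt : ∀ i, i + 1 ≤ n → w i < w (i + 1) := by
    intro i hi
    rw [← ha.lt_iff_lt, hw i (by omega), hw (i + 1) hi]
    exact hu.1 (Set.mem_Iic.2 (by omega)) (Set.mem_Iic.2 hi) (Nat.lt_succ_self i)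
  refine ⟨fun i => if i ≤ n then w i else w n + i, strictMono_nat_of_lt_succ fun i => ?_, ?_⟩
  · by_cases h1 : i + 1 ≤ n
    · simp only [h1, if_true, show i ≤ n by omega]
      exact hlt i h1
    · by_cases h2 : i ≤ n
      · obtain rfl : i = n := by omega
        simp
      · simp [h1, h2]
  · intro i hi
    simp only [hi, if_true, hw i hi]

variable [Nonempty κ]

/-- The increasing enumeration of a finite set, arbitrary beyond its cardinality. -/
noncomputable def enumFinset (s : Finset κ) (i : ℕ) : κ :=
  if h : i < s.card then s.orderEmbOfFin rfl ⟨i, h⟩ else Classical.arbitrary κ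

theorem enumFinset_mem {s : Finset κ} {i : ℕ} (h : i < s.card) : enumFinset s i ∈ s := by
  rw [enumFinset, dif_pos h]
  exact s.orderEmbOfFin_mem rfl _

theorem enumFinset_lt {s : Finset κ} {i j : ℕ} (hj : j < s.card) (hij : i < j) :
    enumFinset s i < enumFinset s j := by
  rw [enumFinset, enumFinset, dif_pos (hij.trans hj), dif_pos hj]
  exact (s.orderEmbOfFin rfl).strictMono hij

theorem enumFinset_le {s : Finset κ} {i j : ℕ} (hj : j < s.card) (hij : i ≤ j) :
    enumFinset s i ≤ enumFinset s j := by
  rcases hij.eq_or_lt with rfl | h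
  · exact le_rfl
  · exact (enumFinset_lt hj h).le

theorem enumFinset_inj {s : Finset κ} {i j : ℕ} (hi : i < s.card) (hj : j < s.card)
    (h : enumFinset s i = enumFinset s j) : i = j := by
  rcases lt_trichotomy i j with h' | h' | h'
  · exact absurd h (enumFinset_lt hj h').ne
  · exact h'
  · exact absurd h (enumFinset_lt hi h').ne'

theorem exists_enumFinset_eq (s : Finset κ) (a : κ) :
    ∃ i, a ∈ s → i < s.card ∧ enumFinset s i = a := by
  by_cases ha : a ∈ s
  · have : a ∈ Set.range (s.orderEmbOfFin rfl) := by
      rw [Finset.range_orderEmbOfFin]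
      exact ha
    obtain ⟨i, hi⟩ := this
    refine ⟨i, fun _ => ⟨i.2, ?_⟩⟩
    rw [enumFinset, dif_pos i.2]
    exact hi
  · exact ⟨0, fun h => absurd h ha⟩

/-- The position of an element in a finite set. -/
noncomputable def indexIn (s : Finset κ) (a : κ) : ℕ :=
  (exists_enumFinset_eq s a).choose

theorem indexIn_lt {s : Finset κ} {a : κ} (ha : a ∈ s) : indexIn s a < s.card :=
  ((exists_enumFinset_eq s a).choose_spec ha).1

theorem enumFinset_indexIn {s : Finset κ} {a : κ} (ha : a ∈ s) : enumFinset s (indexIn s a) = a :=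
  ((exists_enumFinset_eq s a).choose_spec ha).2

theorem indexIn_lt_indexIn {s : Finset κ} {a b : κ} (ha : a ∈ s) (hb : b ∈ s) (hab : a < b) :
    indexIn s a < indexIn s b := by
  by_contra h
  have := enumFinset_le (indexIn_lt ha) (not_lt.1 h)
  rw [enumFinset_indexIn ha, enumFinset_indexIn hb] at this
  exact absurd hab (not_lt.2 this)

theorem tupleIn_enumFinset_comp {n : ℕ} {s : Finset κ} {p : ℕ → ℕ}
    (hp : StrictMonoOn p (Set.Iic n)) (hlt : ∀ i ≤ n, p i < s.card) :
    TupleIn n s (enumFinset s ∘ p) :=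
  ⟨fun _ hi j hj hij => enumFinset_lt (hlt j hj) (hp hi hj hij),
    fun i hi => enumFinset_mem (hlt i hi)⟩

end enumeration

theorem inDeltaPosition_of_initial_segments_eq {κ : Type*} [LinearOrder κ] {s t : Finset κ} {k : ℕ} {γ : κ}
    (hst : ∀ x, x ≤ γ → (x ∈ s ↔ x ∈ t)) (hk : ((s ∩ t).filter (γ < ·)).card ≤ k) :
    InDeltaPosition (k : ℤ) s t := by
  refine ⟨s.filter (· ≤ γ), (s ∩ t).filter (γ < ·), ?_, ?_, by exact_mod_cast hk, ⟨?_, ?_⟩, ?_, ?_⟩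
  · intro a ha b hb
    exact (Finset.mem_filter.1 ha).2.trans_lt (Finset.mem_filter.1 hb).2
  · ext x
    simp only [Finset.mem_inter, Finset.mem_union, Finset.mem_filter]
    by_cases hx : x ≤ γ
    · have := hst x hx
      simp [hx, not_lt.2 hx, this]
    · simp [hx, not_le.1 hx]
  · exact Finset.filter_subset _ _
  · intro a ha b hb
    simp only [Finset.mem_sdiff, Finset.mem_filter, not_and, not_le] at ha hb
    exact ha.2.trans_lt (hb.2 hb.1)
  · intro x hx
    rw [Finset.mem_filter] at hx
    exact (hst x hx.2).1 hx.1
  · intro a ha b hb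
    simp only [Finset.mem_sdiff, Finset.mem_filter, not_and, not_le] at ha hb
    by_contra hab
    have hbγ := (not_lt.1 hab).trans ha.2
    exact absurd (hb.2 ((hst b hbγ).2 hb.1)) (not_lt.2 hbγ)

/-! ### The very-large family and its countable colouring. -/

section family

variable {κ : Type*} [LinearOrder κ]

/-- The finite sets on whose increasing `(n + 1)`-tuples the reduction behaves well and
determines the first element. -/
def reductionFamily (e : Ordinal.{0} → Ordinal.{0} → Ordinal.{0}) (τ : κ → Ordinal.{0}) (n : ℕ) :
    Set (Finset κ) :=
  {s | ∀ u, TupleIn n s u → ReduceIncreasing e n (τ ∘ u) ∧ reduce e n (τ ∘ u) < ω ∧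
    ∀ v, TupleIn n s v → reduce e n (τ ∘ u) = reduce e n (τ ∘ v) → u 0 = v 0}

variable {e : Ordinal.{0} → Ordinal.{0} → Ordinal.{0}} {τ : κ → Ordinal.{0}} {n : ℕ}

theorem isVeryLarge_reductionFamily [WellFoundedLT κ] (hinj : ∀ γ, Set.InjOn (e γ) (Set.Iio γ))
    (he : ∀ γ, ∀ α < γ, e γ α < γ.card.ord) (hτ : StrictMono τ) (hτn : ∀ α, τ α < ω_ n) :
    IsVeryLarge (reductionFamily e τ n) := by
  intro A hA
  obtain ⟨a, ha, haA⟩ := exists_strictMono_mem_of_infinite hA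
  obtain ⟨φ, hφ, hinc⟩ := exists_reduceIncreasing_subsequence hinj (hτ.comp ha) n
  obtain ⟨ψ, hψ, hdet⟩ := exists_subsequence_determining_head n
    (fun u => reduce e n ((τ ∘ a) ∘ φ ∘ u))
    (fun u v h => reduce_congr e n fun i hi => by simp [h i hi])
    (fun u v hu hv htail h => by
      have := head_eq_of_reduce_eq hinj n (hinc u hu) (hinc v hv)
        (fun i _ => by simp [htail i]) h
      exact ((hτ.comp ha).comp hφ).injective this)
  have ha' : StrictMono (a ∘ φ ∘ ψ) := ha.comp (hφ.comp hψ)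
  refine ⟨Set.range (a ∘ φ ∘ ψ), ?_, Set.infinite_range_of_injective ha'.injective, ?_⟩
  · rintro _ ⟨i, rfl⟩
    exact haA _
  intro s hs u hu
  obtain ⟨w, hw, hwu⟩ := hu.exists_strictMono_index ha' hs
  have hwu' : ∀ i ≤ n, ((τ ∘ a) ∘ φ ∘ ψ ∘ w) i = (τ ∘ u) i := fun i hi => congrArg τ (hwu i hi)
  refine ⟨(hinc (ψ ∘ w) (hψ.comp hw)).congr hwu', ?_, ?_⟩
  · rw [← reduce_congr e n hwu']
    have := reduce_lt_omega he (a := (τ ∘ a) ∘ φ) (fun i => hτn _) hinc n 0 rfl (ψ ∘ w)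
      (hψ.comp hw)
    rwa [Nat.cast_zero, Ordinal.omega_zero] at this
  · intro v hv huv
    obtain ⟨w', hw', hwv⟩ := hv.exists_strictMono_index ha' hs
    have hwv' : ∀ i ≤ n, ((τ ∘ a) ∘ φ ∘ ψ ∘ w') i = (τ ∘ v) i := fun i hi => congrArg τ (hwv i hi)
    rw [← reduce_congr e n hwu', ← reduce_congr e n hwv'] at huv
    rw [← hwu 0 (Nat.zero_le n), ← hwv 0 (Nat.zero_le n), hdet w w' hw hw' huv]

variable [Nonempty κ]

/-- The cardinality of a finite set together with the reductions of its `(n + 1)`-tuples. -/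
noncomputable def reductionColor (e : Ordinal.{0} → Ordinal.{0} → Ordinal.{0})
    (τ : κ → Ordinal.{0}) (n : ℕ) (s : Finset κ) : Σ m : ℕ, ((Fin (n + 1) → Fin m) → ℕ) :=
  ⟨s.card, fun p => Cardinal.toNat
    (reduce e n fun i => τ (enumFinset s (p (Fin.ofNat (n + 1) i)))).card⟩

theorem card_eq_of_reductionColor_eq {s t : Finset κ}
    (h : reductionColor e τ n s = reductionColor e τ n t) : s.card = t.card :=
  congrArg Sigma.fst h

theorem reduce_eq_of_reductionColor_eq {s t : Finset κ} (hs : s ∈ reductionFamily e τ n)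
    (ht : t ∈ reductionFamily e τ n) (h : reductionColor e τ n s = reductionColor e τ n t)
    {p : ℕ → ℕ} (hp : StrictMonoOn p (Set.Iic n)) (hlt : ∀ i ≤ n, p i < s.card) :
    reduce e n (τ ∘ enumFinset s ∘ p) = reduce e n (τ ∘ enumFinset t ∘ p) := by
  have hlt' : ∀ i ≤ n, p i < t.card := card_eq_of_reductionColor_eq h ▸ hlt
  have h1 := (hs _ (tupleIn_enumFinset_comp hp hlt)).2.1
  have h2 := (ht _ (tupleIn_enumFinset_comp hp hlt')).2.1
  -- The entry at `p` is read off by a function defined on all colours, with default `0`, so that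
  -- equality of colours transports without dependent rewriting. Passing to cardinals loses nothing,
  -- since both reductions are below `ω`.
  have key : ∀ s' : Finset κ, (hlt : ∀ i ≤ n, p i < s'.card) →
      (fun c : Σ m : ℕ, ((Fin (n + 1) → Fin m) → ℕ) =>
        if hc : ∀ i : Fin (n + 1), p i < c.1 then c.2 fun i => ⟨p i, hc i⟩ else 0)
        (reductionColor e τ n s') =
      Cardinal.toNat (reduce e n (τ ∘ enumFinset s' ∘ p)).card := by
    intro s' hlt
    have hc : ∀ i : Fin (n + 1), p i < (reductionColor e τ n s').1 := fun i => hlt i (by omega)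
    simp only [hc, implies_true, dif_pos]
    simp only [reductionColor]
    congr 2
    refine reduce_congr e n fun i hi => ?_
    simp [Nat.mod_eq_of_lt (Nat.lt_succ_of_le hi)]
  have h3 := (key s hlt).symm.trans ((congrArg (fun c : Σ m : ℕ, ((Fin (n + 1) → Fin m) → ℕ) =>
    if hc : ∀ i : Fin (n + 1), p i < c.1 then c.2 fun i => ⟨p i, hc i⟩ else 0) h).trans
    (key t hlt'))
  obtain ⟨k, hk⟩ := Ordinal.lt_omega0.1 h1
  obtain ⟨l, hl⟩ := Ordinal.lt_omega0.1 h2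
  rw [hk, hl] at h3 ⊢
  simpa using h3

/-- Let `q` be the positions of `u` in `t`. Equal colours give the tuple of `s` at positions `q` the
same number as `u`, and within `s` this number determines the head. -/
theorem indexIn_eq_of_reductionColor_eq {s t : Finset κ} (hs : s ∈ reductionFamily e τ n)
    (ht : t ∈ reductionFamily e τ n) (h : reductionColor e τ n s = reductionColor e τ n t)
    {u : ℕ → κ} (hu : TupleIn n (s ∩ t) u) : indexIn s (u 0) = indexIn t (u 0) := by
  have hus : ∀ i ≤ n, u i ∈ s := fun i hi => (Finset.mem_inter.1 (hu.2 i hi)).1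
  have hut : ∀ i ≤ n, u i ∈ t := fun i hi => (Finset.mem_inter.1 (hu.2 i hi)).2
  have hcard := card_eq_of_reductionColor_eq h
  have hp : StrictMonoOn (indexIn s ∘ u) (Set.Iic n) := fun i hi j hj hij =>
    indexIn_lt_indexIn (hus i hi) (hus j hj) (hu.1 hi hj hij)
  have hq : StrictMonoOn (indexIn t ∘ u) (Set.Iic n) := fun i hi j hj hij =>
    indexIn_lt_indexIn (hut i hi) (hut j hj) (hu.1 hi hj hij)
  have hp' : ∀ i ≤ n, (indexIn s ∘ u) i < s.card := fun i hi => indexIn_lt (hus i hi)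
  have hq' : ∀ i ≤ n, (indexIn t ∘ u) i < s.card := fun i hi => hcard ▸ indexIn_lt (hut i hi)
  have h1 : reduce e n (τ ∘ enumFinset s ∘ indexIn s ∘ u) = reduce e n (τ ∘ u) :=
    reduce_congr e n fun i hi => congrArg τ (enumFinset_indexIn (hus i hi))
  have h2 : reduce e n (τ ∘ enumFinset t ∘ indexIn t ∘ u) = reduce e n (τ ∘ u) :=
    reduce_congr e n fun i hi => congrArg τ (enumFinset_indexIn (hut i hi))
  have h3 := reduce_eq_of_reductionColor_eq hs ht h hq hq'
  exact enumFinset_inj (hp' 0 (Nat.zero_le n)) (hq' 0 (Nat.zero_le n))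
    ((hs _ (tupleIn_enumFinset_comp hp hp')).2.2 _ (tupleIn_enumFinset_comp hq hq')
      (h1.trans (h3.trans h2).symm))

theorem enumFinset_eq_of_reductionColor_eq (hinj : ∀ γ, Set.InjOn (e γ) (Set.Iio γ))
    (hτ : StrictMono τ) {s t : Finset κ} (hs : s ∈ reductionFamily e τ n)
    (ht : t ∈ reductionFamily e τ n) (h : reductionColor e τ n s = reductionColor e τ n t)
    {p : ℕ → ℕ} (hp : StrictMonoOn p (Set.Iic n)) (hlt : ∀ i ≤ n, p i < s.card)
    (htail : ∀ i < n, enumFinset s (p (i + 1)) = enumFinset t (p (i + 1))) :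
    enumFinset s (p 0) = enumFinset t (p 0) := by
  have hlt' : ∀ i ≤ n, p i < t.card := card_eq_of_reductionColor_eq h ▸ hlt
  exact hτ.injective (head_eq_of_reduce_eq hinj n (hs _ (tupleIn_enumFinset_comp hp hlt)).1
    (ht _ (tupleIn_enumFinset_comp hp hlt')).1 (fun i hi => congrArg τ (htail i hi))
    (reduce_eq_of_reductionColor_eq hs ht h hp hlt))

theorem inDeltaPosition_of_reductionColor_eq (hinj : ∀ γ, Set.InjOn (e γ) (Set.Iio γ))
    (hτ : StrictMono τ) {s t : Finset κ} (hs : s ∈ reductionFamily e τ n)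
    (ht : t ∈ reductionFamily e τ n) (h : reductionColor e τ n s = reductionColor e τ n t)
    (hne : s ≠ t) : InDeltaPosition (2 * (n : ℤ) - 1) s t := by
  have hcard := card_eq_of_reductionColor_eq h
  -- For `n = 0` the bound is `-1`, which no pair satisfies, so distinct sets must get distinct
  -- colours: the colour then records every element.
  rcases n.eq_zero_or_pos with rfl | hn
  · refine absurd ?_ hne
    refine Finset.eq_of_subset_of_card_le (fun x hx => ?_) hcard.ge
    have := enumFinset_eq_of_reductionColor_eq hinj hτ hs ht h (p := fun _ => indexIn s x)
      (fun i hi j hj hij => absurd hij (by simp_all)) (fun _ _ => indexIn_lt hx)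
      (fun i hi => absurd hi (by omega))
    rw [enumFinset_indexIn hx] at this
    rw [this]
    exact enumFinset_mem (hcard ▸ indexIn_lt hx)
  have hcast : (2 * (n : ℤ) - 1) = ((2 * n - 1 : ℕ) : ℤ) := by omega
  rw [hcast]
  set r := (s ∩ t).card with hr
  by_cases hrn : r ≤ 2 * n - 1
  · exact ⟨∅, s ∩ t, by simp [BlockLT], by simp, by exact_mod_cast hrn,
      ⟨by simp, by simp [BlockLT]⟩, by simp, by simp [BlockLT]⟩
  -- These are the last `2n` common elements. For `j < n`, the elements `γ j, …, γ (j + n)` form an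
  -- `(n + 1)`-tuple of `s ∩ t`, so `γ j` has the same position in `s` and `t`.
  let γ : ℕ → κ := fun j => enumFinset (s ∩ t) (r - 2 * n + j)
  have hγs : ∀ j < n, γ j ∈ s := fun j hj =>
    (Finset.mem_inter.1 (enumFinset_mem (by omega))).1
  have hγt : ∀ j < n, γ j ∈ t := fun j hj =>
    (Finset.mem_inter.1 (enumFinset_mem (by omega))).2
  have hγ : ∀ j < n, indexIn s (γ j) = indexIn t (γ j) := by
    intro j hj
    exact indexIn_eq_of_reductionColor_eq hs ht h (u := fun i => γ (j + i))
      ⟨fun a ha b hb hab => enumFinset_lt (by simp only [Set.mem_Iic] at hb; omega) (by omega),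
        fun i hi => enumFinset_mem (by omega)⟩
  -- Put `i` in front of the common positions of `γ 0, …, γ (n - 1)`: the tails agree, hence so do
  -- the heads.
  have hlow : ∀ i < indexIn s (γ 0), enumFinset s i = enumFinset t i := by
    intro i hi
    refine enumFinset_eq_of_reductionColor_eq hinj hτ hs ht h
      (p := consSeq i fun j => indexIn s (γ j)) ?_ ?_ ?_
    · have hmono : ∀ j l, j < l → l < n → indexIn s (γ j) < indexIn s (γ l) := fun j l hjl hl =>
        indexIn_lt_indexIn (hγs j (by omega)) (hγs l hl) (enumFinset_lt (by omega) (by omega))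
      rintro (_ | a) ha (_ | b) hb hab
      · omega
      · rcases b with _ | b
        · exact hi
        · exact hi.trans (hmono 0 (b + 1) (by omega) (by simp only [Set.mem_Iic] at hb; omega))
      · omega
      · exact hmono a b (by omega) (by simp only [Set.mem_Iic] at hb; omega)
    · rintro (_ | j) hj
      · exact hi.trans (indexIn_lt (hγs 0 hn))
      · exact indexIn_lt (hγs j (by omega))
    · intro j hj
      change enumFinset s (indexIn s (γ j)) = enumFinset t (indexIn s (γ j))
      rw [enumFinset_indexIn (hγs j hj), hγ j hj, enumFinset_indexIn (hγt j hj)]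
  refine inDeltaPosition_of_initial_segments_eq (γ := γ 0) (fun x hx => ?_) ?_
  · have h0s := indexIn_lt (hγs 0 hn)
    rcases hx.eq_or_lt with rfl | hx
    · exact iff_of_true (hγs 0 hn) (hγt 0 hn)
    constructor
    · intro hxs
      have hlt := indexIn_lt_indexIn hxs (hγs 0 hn) hx
      rw [← enumFinset_indexIn hxs, hlow _ hlt]
      exact enumFinset_mem (by omega)
    · intro hxt
      have hlt := indexIn_lt_indexIn hxt (hγt 0 hn) hx
      rw [← hγ 0 hn] at hlt
      rw [← enumFinset_indexIn hxt, ← hlow _ hlt]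
      exact enumFinset_mem (by omega)
  · have : (s ∩ t).filter (γ 0 < ·) ⊆
        (Finset.Ico (r - 2 * n + 1) r).image (enumFinset (s ∩ t)) := by
      intro x hx
      rw [Finset.mem_filter] at hx
      refine Finset.mem_image.2 ⟨indexIn (s ∩ t) x, Finset.mem_Ico.2 ⟨?_, indexIn_lt hx.1⟩,
        enumFinset_indexIn hx.1⟩
      by_contra hlt
      have := enumFinset_le (s := s ∩ t) (i := indexIn (s ∩ t) x) (j := r - 2 * n + 0)
        (by omega) (by omega)
      rw [enumFinset_indexIn hx.1] at this
      exact absurd hx.2 (not_lt.2 this)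
    refine (Finset.card_le_card this).trans (Finset.card_image_le.trans ?_)
    rw [Nat.card_Ico]
    omega

end family

/-- A countable colouring of a very-large family with colour classes in `Δ`-position. -/
theorem exists_veryLarge_coloring (n : ℕ) : ∃ 𝓑 : Set (Finset (ω_ (n : Ordinal.{0})).ToType),
    IsVeryLarge 𝓑 ∧ ∃ c : Finset (ω_ (n : Ordinal.{0})).ToType → ℕ, ∀ s ∈ 𝓑, ∀ t ∈ 𝓑,
      c s = c t → s ≠ t → InDeltaPosition (2 * (n : ℤ) - 1) s t := by
  obtain ⟨e, hinj, he⟩ := exists_initial_injections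
  let τ : (ω_ (n : Ordinal.{0})).ToType → Ordinal.{0} := fun α => (Ordinal.ToType.mk.symm α).1
  have hτ : StrictMono τ := fun α β h => Ordinal.ToType.mk.symm.strictMono h
  have : Nonempty (ω_ (n : Ordinal.{0})).ToType :=
    Ordinal.nonempty_toType_iff.2 (Ordinal.omega_pos _).ne'
  obtain ⟨g, hg⟩ := exists_injective_nat (Σ m : ℕ, ((Fin (n + 1) → Fin m) → ℕ))
  exact ⟨reductionFamily e τ n,
    isVeryLarge_reductionFamily hinj he hτ fun α => (Ordinal.ToType.mk.symm α).2,
    fun s => g (reductionColor e τ n s), fun s hs t ht h hne =>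
      inDeltaPosition_of_reductionColor_eq hinj hτ hs ht (hg h) hne⟩

/-! ### No finite colouring suffices. -/

theorem infinite_of_coloring_positionalGraphOn {κ : Type*} [LinearOrder κ] [WellFoundedLT κ]
    [Infinite κ] {𝓑 : Set (Finset κ)} (h𝓑 : IsVeryLarge 𝓑) (n : ℕ) {C : Type*}
    (c : (positionalGraphOn (2 * (n : ℤ) - 1) 𝓑).Coloring C) : Infinite C := by
  by_contra hC
  rw [not_infinite_iff_finite] at hC
  have := Fintype.ofFinite C
  obtain ⟨B, -, hB, hB𝓑⟩ := h𝓑 Set.univ Set.infinite_univ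
  obtain ⟨a, ha, haB⟩ := exists_strictMono_mem_of_infinite hB
  set m := Fintype.card C + 1 with hm
  -- The sets `{a i} ∪ R` with `i < m` form a clique larger than the set of colours. Two of them
  -- meet in `R`; since `a i` lies below `R` and is not common, only `I = ∅` is possible, and `R`
  -- has one element too many for `J`.
  let R : Finset κ := (Finset.Ico m (m + 2 * n)).image a
  have hR : R.card = 2 * n := by
    rw [Finset.card_image_of_injective _ ha.injective, Nat.card_Ico]
    omega
  have hlt : ∀ i < m, ∀ x ∈ R, a i < x := by
    intro i hi x hx
    obtain ⟨j, hj, rfl⟩ := Finset.mem_image.1 hx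
    exact ha (hi.trans_le (Finset.mem_Ico.1 hj).1)
  let S : ℕ → Finset κ := fun i => insert (a i) R
  have hS : ∀ i, S i ∈ 𝓑 := by
    intro i
    refine hB𝓑 _ fun x hx => ?_
    simp only [S, R, Finset.coe_insert, Finset.coe_image, Set.mem_insert_iff, Set.mem_image] at hx
    rcases hx with rfl | ⟨j, -, rfl⟩
    · exact haB i
    · exact haB j
  have hinter : ∀ i < m, ∀ j < m, i ≠ j → a i ∉ S j := by
    intro i hi j hj hij h
    rcases Finset.mem_insert.1 h with h | h
    · exact hij (ha.injective h)
    · exact absurd (hlt i hi _ h) (lt_irrefl _)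
  have hadj : ∀ i < m, ∀ j < m, i ≠ j →
      (positionalGraphOn (2 * (n : ℤ) - 1) 𝓑).Adj ⟨S i, hS i⟩ ⟨S j, hS j⟩ := by
    intro i hi j hj hij
    refine ⟨fun h => hinter i hi j hj hij ?_, ?_⟩
    · change S i = S j at h
      rw [← h]
      exact Finset.mem_insert_self _ _
    · rintro ⟨I, J, -, h2, h3, h4, -⟩
      change S i ∩ S j = I ∪ J at h2
      have hI : ∀ x ∈ I, x ∈ R := by
        intro x hx
        have hx' : x ∈ S i ∩ S j := h2 ▸ Finset.mem_union_left _ hx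
        rw [Finset.mem_inter] at hx'
        rcases Finset.mem_insert.1 hx'.1 with rfl | h
        · exact absurd hx'.2 (hinter i hi j hj hij)
        · exact h
      have hIe : I = ∅ := by
        rw [Finset.eq_empty_iff_forall_notMem]
        intro x hx
        have hai : a i ∈ S i \ I := by
          refine Finset.mem_sdiff.2 ⟨Finset.mem_insert_self _ _, fun h => ?_⟩
          exact absurd (hlt i hi _ (hI _ h)) (lt_irrefl _)
        exact absurd (h4.2 x hx _ hai) (hlt i hi x (hI x hx)).asymm
      rw [hIe, Finset.empty_union] at h2
      have : R ⊆ J := by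
        rw [← h2]
        exact fun x hx => Finset.mem_inter.2
          ⟨Finset.mem_insert_of_mem hx, Finset.mem_insert_of_mem hx⟩
      have := Finset.card_le_card this
      omega
  obtain ⟨i, j, hij, h⟩ := Fintype.exists_ne_map_eq_of_card_lt
    (fun i : Fin m => c ⟨S i, hS i⟩) (by simp [hm])
  exact c.valid (hadj i i.2 j j.2 fun h => hij (Fin.ext h)) h

theorem exists_veryLarge_chromaticCardinal (n : ℕ) :
    ∃ 𝓑 : Set (Finset (ω_ (n : Ordinal.{0})).ToType),
      IsVeryLarge 𝓑 ∧ chromaticCardinal (positionalGraphOn (2 * (n : ℤ) - 1) 𝓑) = ℵ₀ := by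
  obtain ⟨𝓑, h𝓑, c, hc⟩ := exists_veryLarge_coloring n
  have : Infinite (ω_ (n : Ordinal.{0})).ToType := by
    rw [Cardinal.infinite_iff, Cardinal.mk_toType, Ordinal.card_omega]
    exact Cardinal.aleph0_le_aleph _
  refine ⟨𝓑, h𝓑, le_antisymm (csInf_le' ⟨ℕ, Cardinal.mk_nat, ⟨?_⟩⟩) (le_csInf ?_ ?_)⟩
  · refine SimpleGraph.Coloring.mk (fun s => c s) fun {s t} hst h => ?_
    exact hst.2 (hc s s.2 t t.2 h hst.1)
  · exact ⟨_, _, rfl, ⟨SimpleGraph.selfColoring _⟩⟩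
  · rintro _ ⟨C, rfl, ⟨f⟩⟩
    rw [← Cardinal.infinite_iff]
    exact infinite_of_coloring_positionalGraphOn h𝓑 n f

/-! ### From a set of functionals to a normed space. -/

section space

variable {κ : Type}

/-- If `f (x α) ≥ ε` held infinitely often, summing over `m ^ 4` such indices would give `ε * m ^ 4
≤ ‖f‖ * C * m ^ 3` for every positive `m`. -/
theorem isWeaklyNull_of_norm_sum_le {X : Type*} [NormedAddCommGroup X] [NormedSpace ℝ X]
    {x : κ → X} {C : ℝ} (h : ∀ (m : ℕ) (H : Finset κ), H.card = m ^ 4 → ‖∑ α ∈ H, x α‖ ≤ C * m ^ 3) :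
    IsWeaklyNull x := by
  have key : ∀ (f : X →L[ℝ] ℝ) (ε : ℝ), 0 < ε → {α | ε ≤ f (x α)}.Finite := by
    intro f ε hε
    by_contra hinf
    obtain ⟨m, hm⟩ := exists_nat_gt (‖f‖ * C / ε)
    obtain ⟨H, hH, hcard⟩ := Set.Infinite.exists_subset_card_eq hinf ((m + 1) ^ 4)
    have h1 : ε * (m + 1 : ℝ) ^ 4 ≤ f (∑ α ∈ H, x α) := by
      rw [map_sum]
      calc ε * (m + 1 : ℝ) ^ 4 = ∑ α ∈ H, ε := by
            rw [Finset.sum_const, hcard, nsmul_eq_mul]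
            push_cast
            ring
        _ ≤ _ := Finset.sum_le_sum fun α hα => hH hα
    have h2 : f (∑ α ∈ H, x α) ≤ ‖f‖ * (C * (m + 1 : ℝ) ^ 3) := by
      refine (Real.le_norm_self _).trans ((f.le_opNorm _).trans ?_)
      have := h (m + 1) H hcard
      push_cast at this
      exact mul_le_mul_of_nonneg_left this (norm_nonneg _)
    have h3 : 0 < (m + 1 : ℝ) ^ 3 := by positivity
    have h4 : (ε * (m + 1)) * (m + 1 : ℝ) ^ 3 ≤ (‖f‖ * C) * (m + 1 : ℝ) ^ 3 := by
      refine le_of_eq_of_le ?_ ((h1.trans h2).trans_eq ?_) <;> ring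
    have h5 := le_of_mul_le_mul_right h4 h3
    rw [div_lt_iff₀ hε] at hm
    nlinarith
  intro f
  rw [Metric.tendsto_nhds]
  intro ε hε
  rw [Filter.eventually_cofinite]
  refine ((key f ε hε).union (key (-f) ε hε)).subset fun α hα => ?_
  simp only [Set.mem_ofPred_eq, dist_zero_right, Real.norm_eq_abs, not_lt] at hα
  rcases le_abs.1 hα with h | h
  · exact Or.inl h
  · exact Or.inr h

/-- Splitting `s` according to whether `b α = a α`, the `a`-sum is the difference of two partial
sums of the `b`-sum, so unconditionality would bound it by `2 * (K * C)`. -/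
theorem not_isUnconditionalBasicSequence {X : Type*} [LinearOrder κ] [NormedAddCommGroup X]
    [NormedSpace ℝ X] {x : κ → X} {C : ℝ} {A : Set κ}
    (h : ∀ m : ℕ, ∃ s : Finset κ, (s : Set κ) ⊆ A ∧ ∃ a b : κ → ℝ,
      (∀ α ∈ s, b α = a α ∨ b α = -a α) ∧ (m : ℝ) ≤ ‖∑ α ∈ s, a α • x α‖ ∧
      ‖∑ α ∈ s, b α • x α‖ ≤ C) :
    ¬ IsUnconditionalBasicSequence fun α : A => x α := by
  classical
  rintro ⟨-, K, hK, hu⟩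
  obtain ⟨m, hm⟩ := exists_nat_gt (2 * (K * C))
  obtain ⟨s, hsA, a, b, hab, hlow, hup⟩ := h m
  have hsub : ∀ t ⊆ s, ‖∑ α ∈ t, b α • x α‖ ≤ K * C := by
    intro t ht
    have := hu (s.subtype (· ∈ A)) (t.subtype (· ∈ A)) (fun α => b α)
      (Finset.subtype_mono ht)
    rw [Finset.sum_subtype_of_mem (fun α => b α • x α) fun α hα => hsA (ht hα),
      Finset.sum_subtype_of_mem (fun α => b α • x α) fun α hα => hsA hα] at this
    exact this.trans (mul_le_mul_of_nonneg_left hup (zero_le_one.trans hK))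
  have h1 := hsub (s.filter fun α => b α = a α) (Finset.filter_subset _ _)
  have h2 := hsub (s.filter fun α => ¬ b α = a α) (Finset.filter_subset _ _)
  have h3 : ∑ α ∈ s, a α • x α = ∑ α ∈ s with b α = a α, b α • x α -
      ∑ α ∈ s with ¬ b α = a α, b α • x α := by
    rw [← Finset.sum_filter_add_sum_filter_not s (fun α => b α = a α), sub_eq_add_neg,
      ← Finset.sum_neg_distrib]
    congr 1
    · refine Finset.sum_congr rfl fun α hα => ?_
      rw [(Finset.mem_filter.1 hα).2]
    · refine Finset.sum_congr rfl fun α hα => ?_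
      rw [Finset.mem_filter] at hα
      rw [(hab α hα.1).resolve_left hα.2, neg_smul, neg_neg]
  have h4 := norm_sub_le (∑ α ∈ s with b α = a α, b α • x α)
    (∑ α ∈ s with ¬ b α = a α, b α • x α)
  rw [← h3] at h4
  linarith

/-- The sequence of evaluations on a set of functionals bounded by one on the unit vectors. -/
theorem exists_weaklyNull_of_functionals [LinearOrder κ] (Φ : Set (κ → ℝ))
    (hb : ∀ w ∈ Φ, ∀ α, |w α| ≤ 1) (h1 : ∀ α, ∃ w ∈ Φ, w α = 1)
    {C : ℝ} (hC : 0 ≤ C) (havg : ∀ w ∈ Φ, ∀ (m : ℕ) (H : Finset κ), H.card = m ^ 4 →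
      |∑ α ∈ H, w α| ≤ C * m ^ 3)
    (hcond : ∀ A : Set κ, A.Infinite → ∀ m : ℕ, ∃ s : Finset κ, (s : Set κ) ⊆ A ∧ ∃ a b : κ → ℝ,
      (∀ α ∈ s, b α = a α ∨ b α = -a α) ∧ (∃ w ∈ Φ, (m : ℝ) ≤ |∑ α ∈ s, a α * w α|) ∧
      ∀ w ∈ Φ, |∑ α ∈ s, b α * w α| ≤ C) :
    ∃ (X : Type) (_ : NormedAddCommGroup X) (_ : NormedSpace ℝ X) (_ : CompleteSpace X)
      (x : κ → X), (∀ α, ‖x α‖ = 1) ∧ IsWeaklyNull x ∧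
      ∀ A : Set κ, A.Infinite → ¬ IsUnconditionalBasicSequence (fun α : A => x α) := by
  -- With the discrete topology, the bounded continuous functions are all the bounded functions on
  -- `Φ`, with the supremum norm.
  let _ : TopologicalSpace Φ := ⊥
  have : DiscreteTopology Φ := ⟨rfl⟩
  let x : κ → BoundedContinuousFunction Φ ℝ := fun α =>
    BoundedContinuousFunction.ofNormedAddCommGroupDiscrete (fun w => w.1 α) 1 fun w => hb w w.2 α
  have hx : ∀ α w, x α w = w.1 α := fun _ _ => rfl
  have hsum : ∀ (s : Finset κ) (a : κ → ℝ) w, (∑ α ∈ s, a α • x α) w = ∑ α ∈ s, a α * w.1 α := by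
    intro s a w
    rw [BoundedContinuousFunction.sum_apply]
    exact Finset.sum_congr rfl fun α _ => by
      rw [BoundedContinuousFunction.smul_apply, hx, smul_eq_mul]
  refine ⟨BoundedContinuousFunction Φ ℝ, inferInstance, inferInstance, inferInstance, x,
    fun α => le_antisymm ?_ ?_, isWeaklyNull_of_norm_sum_le (C := C) fun m H hH => ?_,
    fun A hA => not_isUnconditionalBasicSequence (C := C) fun m => ?_⟩
  · exact (BoundedContinuousFunction.norm_le zero_le_one).2 fun w => hb w w.2 α
  · obtain ⟨w, hw, hwα⟩ := h1 α
    have := (x α).norm_coe_le_norm ⟨w, hw⟩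
    rw [hx] at this
    change ‖w α‖ ≤ _ at this
    rwa [hwα, norm_one] at this
  · refine (BoundedContinuousFunction.norm_le (by positivity)).2 fun w => ?_
    have := hsum H (fun _ => 1) w
    simp only [one_smul, one_mul] at this
    rw [this]
    exact havg w w.2 m H hH
  · obtain ⟨s, hs, a, b, hab, ⟨w, hw, hlow⟩, hup⟩ := hcond A hA m
    refine ⟨s, hs, a, b, hab, ?_, ?_⟩
    · have := (∑ α ∈ s, a α • x α).norm_coe_le_norm ⟨w, hw⟩
      rw [hsum] at this
      exact hlow.trans this
    · refine (BoundedContinuousFunction.norm_le hC).2 fun w => ?_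
      rw [hsum]
      exact hup w w.2

end space

/-! ### Special sequences of blocks and their pairings. -/

section special

variable {κ : Type*} [LinearOrder κ]

/-- The union of the first `i` blocks. -/
def initUnion (F : ℕ → Finset κ) (i : ℕ) : Finset κ :=
  (Finset.range i).biUnion F

theorem mem_initUnion {F : ℕ → Finset κ} {i : ℕ} {x : κ} :
    x ∈ initUnion F i ↔ ∃ j < i, x ∈ F j := by
  simp [initUnion]

/-- The normalizing weight of a block of cardinality `2 ^ (4 * q ^ 2)`. -/
noncomputable def blockWeight (q : ℕ) : ℝ :=
  ((2 : ℝ) ^ (2 * q ^ 2))⁻¹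

/-- Special sequences of blocks: the size of each block codes the previous ones. -/
structure IsSpecial (𝓑 : Set (Finset κ)) (c : Finset κ → ℕ) (m : ℕ) (F : ℕ → Finset κ)
    (q : ℕ → ℕ) : Prop where
  blockLT : ∀ i j, i < j → j < m → BlockLT (F i) (F j)
  card_eq : ∀ i < m, (F i).card = 2 ^ (4 * q i ^ 2)
  mem : ∀ i < m, initUnion F i ∈ 𝓑
  code : ∀ i < m, q i = Encodable.encode (c (initUnion F i), (List.range i).map q)

/-- The combination of the normalized indicators of the first `m` blocks. -/
noncomputable def blockSum (ε : ℕ → ℝ) (m : ℕ) (F : ℕ → Finset κ) (q : ℕ → ℕ) (α : κ) : ℝ :=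
  ∑ i ∈ Finset.range m, ε i * if α ∈ F i then blockWeight (q i) else 0

theorem blockWeight_pos (q : ℕ) : 0 < blockWeight q := by
  unfold blockWeight
  positivity

theorem blockWeight_le_one (q : ℕ) : blockWeight q ≤ 1 :=
  inv_le_one_of_one_le₀ (one_le_pow₀ one_le_two)

variable {𝓑 : Set (Finset κ)} {c : Finset κ → ℕ} {m m' : ℕ} {F G : ℕ → Finset κ} {q r : ℕ → ℕ}

theorem IsSpecial.notMem (hF : IsSpecial 𝓑 c m F q) {i j : ℕ} (hi : i < m) (hj : j < m)
    (hij : i ≠ j) {x : κ} (hx : x ∈ F i) : x ∉ F j := by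
  intro hx'
  rcases hij.lt_or_gt with h | h
  · exact lt_irrefl _ (hF.blockLT i j h hj x hx x hx')
  · exact lt_irrefl _ (hF.blockLT j i h hi x hx' x hx)

/-- The list inside the code has as many entries as there are earlier blocks, so the code also
remembers its index. -/
theorem IsSpecial.code_eq (hF : IsSpecial 𝓑 c m F q) (hG : IsSpecial 𝓑 c m' G r) {i j : ℕ}
    (hi : i < m) (hj : j < m') (h : q i = r j) :
    i = j ∧ c (initUnion F i) = c (initUnion G i) ∧ ∀ l < i, q l = r l := by
  rw [hF.code i hi, hG.code j hj] at h
  have h' := Encodable.encode_injective h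
  rw [Prod.mk.injEq] at h'
  have hij : i = j := by simpa using congrArg List.length h'.2
  subst hij
  exact ⟨rfl, h'.1, fun l hl => List.map_inj_left.1 h'.2 l (List.mem_range.2 hl)⟩

theorem IsSpecial.injOn (hF : IsSpecial 𝓑 c m F q) : Set.InjOn q (Finset.range m) :=
  fun _ hi _ hj h => (hF.code_eq hF (Finset.mem_range.1 hi) (Finset.mem_range.1 hj) h).1

theorem sum_half_pow_le_two {s : Finset ℕ} {q : ℕ → ℕ} (hq : Set.InjOn q s) :
    ∑ i ∈ s, (1 / 2 : ℝ) ^ q i ≤ 2 := by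
  rw [← Finset.sum_image (f := fun k => (1 / 2 : ℝ) ^ k) hq]
  exact (summable_geometric_two.sum_le_tsum _ fun i _ => by positivity).trans_eq tsum_geometric_two

theorem IsSpecial.blockSum_eq (hF : IsSpecial 𝓑 c m F q) (ε : ℕ → ℝ) {i : ℕ} (hi : i < m) {α : κ}
    (hα : α ∈ F i) : blockSum ε m F q α = ε i * blockWeight (q i) := by
  rw [blockSum, Finset.sum_eq_single i, if_pos hα]
  · intro j hj hji
    rw [if_neg (hF.notMem hi (Finset.mem_range.1 hj) hji.symm hα), mul_zero]
  · exact fun h => absurd (Finset.mem_range.2 hi) h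

theorem IsSpecial.abs_blockSum_le (hF : IsSpecial 𝓑 c m F q) {ε : ℕ → ℝ} (hε : ∀ i, |ε i| ≤ 1)
    (α : κ) : |blockSum ε m F q α| ≤ 1 := by
  by_cases h : ∃ i < m, α ∈ F i
  · obtain ⟨i, hi, hα⟩ := h
    rw [hF.blockSum_eq ε hi hα, abs_mul, abs_of_pos (blockWeight_pos _)]
    exact mul_le_one₀ (hε i) (blockWeight_pos _).le (blockWeight_le_one _)
  · rw [blockSum, Finset.sum_eq_zero, abs_zero]
    · exact zero_le_one
    · intro i hi
      rw [if_neg fun hα => h ⟨i, Finset.mem_range.1 hi, hα⟩, mul_zero]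

theorem sum_blockSum (ε : ℕ → ℝ) (H : Finset κ) : ∑ α ∈ H, blockSum ε m F q α =
    ∑ i ∈ Finset.range m, ε i * (blockWeight (q i) * (H ∩ F i).card) := by
  simp only [blockSum]
  rw [Finset.sum_comm]
  refine Finset.sum_congr rfl fun i _ => ?_
  rw [← Finset.mul_sum, ← Finset.sum_filter, Finset.sum_const, nsmul_eq_mul,
    Finset.filter_mem_eq_inter, mul_comm (blockWeight _)]

/-- With `Q = 2 ^ q ^ 2`, the weight is `1 / Q ^ 2` and `x ≤ min Q m ^ 4 ≤ Q * m ^ 3`. The spare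
factor `1 / Q` makes the bound summable over distinct codes. -/
theorem blockWeight_mul_le {x q m : ℕ} (h1 : x ≤ 2 ^ (4 * q ^ 2)) (h2 : x ≤ m ^ 4) :
    blockWeight q * x ≤ (1 / 2 : ℝ) ^ q * m ^ 3 := by
  set Q : ℕ := 2 ^ q ^ 2 with hQ
  have hxQ : x ≤ Q * m ^ 3 := by
    rcases le_total Q m with h | h
    · calc x ≤ Q ^ 4 := by rw [hQ, ← pow_mul, mul_comm]; exact h1
        _ = Q * Q ^ 3 := by ring
        _ ≤ Q * m ^ 3 := by gcongr
    · calc x ≤ m ^ 4 := h2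
        _ = m * m ^ 3 := by ring
        _ ≤ Q * m ^ 3 := by gcongr
  have hQ0 : (0 : ℝ) < Q := by positivity
  have h3 : blockWeight q = ((Q : ℝ) * Q)⁻¹ := by
    rw [blockWeight, hQ]
    push_cast
    rw [← pow_add, two_mul]
  have h4 : ((Q : ℝ))⁻¹ ≤ (1 / 2) ^ q := by
    rw [one_div, inv_pow, hQ]
    push_cast
    gcongr
    · exact one_le_two
    · exact Nat.le_self_pow two_ne_zero q
  calc blockWeight q * x ≤ ((Q : ℝ) * Q)⁻¹ * (Q * m ^ 3) := by
        rw [h3]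
        gcongr
        exact_mod_cast hxQ
    _ = (Q : ℝ)⁻¹ * m ^ 3 := by field_simp
    _ ≤ _ := by gcongr

theorem IsSpecial.abs_sum_le (hF : IsSpecial 𝓑 c m F q) {k : ℕ} {H : Finset κ}
    (hH : H.card = k ^ 4) : |∑ α ∈ H, blockSum 1 m F q α| ≤ 2 * k ^ 3 := by
  rw [sum_blockSum, abs_of_nonneg]
  · calc _ ≤ ∑ i ∈ Finset.range m, (1 / 2 : ℝ) ^ q i * k ^ 3 := by
          refine Finset.sum_le_sum fun i hi => ?_
          rw [Pi.one_apply, one_mul]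
          refine blockWeight_mul_le ?_ (hH ▸ Finset.card_le_card Finset.inter_subset_left)
          rw [← hF.card_eq i (Finset.mem_range.1 hi)]
          exact Finset.card_le_card Finset.inter_subset_right
      _ ≤ _ := by
          rw [← Finset.sum_mul]
          gcongr
          exact sum_half_pow_le_two hF.injOn
  · refine Finset.sum_nonneg fun i _ => ?_
    have := blockWeight_pos (q i)
    rw [Pi.one_apply]
    positivity

theorem sum_blockSum_mul_blockSum (ε δ : ℕ → ℝ) :
    ∑ α ∈ initUnion F m, blockSum ε m F q α * blockSum δ m' G r α =
      ∑ i ∈ Finset.range m, ∑ j ∈ Finset.range m',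
        ε i * δ j * (blockWeight (q i) * blockWeight (r j) * (F i ∩ G j).card) := by
  simp only [blockSum, Finset.sum_mul_sum]
  rw [Finset.sum_comm]
  refine Finset.sum_congr rfl fun i hi => ?_
  rw [Finset.sum_comm]
  refine Finset.sum_congr rfl fun j _ => ?_
  have h1 : ∀ α, (ε i * if α ∈ F i then blockWeight (q i) else 0) *
      (δ j * if α ∈ G j then blockWeight (r j) else 0) =
      if α ∈ F i ∩ G j then ε i * δ j * (blockWeight (q i) * blockWeight (r j)) else 0 := by
    intro α
    by_cases h : α ∈ F i <;> by_cases h' : α ∈ G j <;> simp [h, h']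
    ring
  have h2 : initUnion F m ∩ (F i ∩ G j) = F i ∩ G j :=
    Finset.inter_eq_right.2 fun α hα =>
      mem_initUnion.2 ⟨i, Finset.mem_range.1 hi, (Finset.mem_inter.1 hα).1⟩
  simp only [h1]
  rw [← Finset.sum_filter, Finset.filter_mem_eq_inter, h2, Finset.sum_const, nsmul_eq_mul]
  ring

theorem blockWeight_mul_self (q : ℕ) : blockWeight q * blockWeight q = ((2 : ℝ) ^ (4 * q ^ 2))⁻¹ := by
  rw [blockWeight, ← mul_inv, ← pow_add]
  congr 2
  ring

theorem IsSpecial.le_sum_mul_self (hF : IsSpecial 𝓑 c m F q) :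
    (m : ℝ) ≤ ∑ α ∈ initUnion F m, blockSum 1 m F q α * blockSum 1 m F q α := by
  rw [sum_blockSum_mul_blockSum]
  calc (m : ℝ) = ∑ i ∈ Finset.range m, (1 : ℝ) := by simp
    _ ≤ _ := Finset.sum_le_sum fun i hi => ?_
  have hnn : ∀ j, 0 ≤ (1 : ℕ → ℝ) i * (1 : ℕ → ℝ) j *
      (blockWeight (q i) * blockWeight (q j) * ((F i ∩ F j).card : ℝ)) := by
    intro j
    have := blockWeight_pos (q i)
    have := blockWeight_pos (q j)
    simp only [Pi.one_apply]
    positivity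
  refine le_trans (le_of_eq ?_) (Finset.single_le_sum (fun j _ => hnn j) hi)
  simp only [Pi.one_apply, Finset.inter_self]
  rw [hF.card_eq i (Finset.mem_range.1 hi), blockWeight_mul_self]
  push_cast
  rw [one_mul, one_mul, inv_mul_cancel₀ (by positivity)]

/-- Blocks of two sequences with the same sizes whose unions are in `Δ`-position agree up to some
index and have small intersections beyond it. -/
theorem exists_agreement_index {K l : ℕ}
    (hF : ∀ i j, i < j → j < l → BlockLT (F i) (F j))
    (hG : ∀ i j, i < j → j < l → BlockLT (G i) (G j))
    (hcard : ∀ i < l, (F i).card = (G i).card)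
    (hΔ : InDeltaPosition (K : ℤ) (initUnion F l) (initUnion G l)) :
    ∃ p ≤ l, (∀ i < p, F i = G i) ∧ ∀ i, p < i → i < l → (F i ∩ G i).card ≤ K := by
  obtain ⟨I, J, -, hIJ, hJ, hIF, hIG⟩ := hΔ
  -- The index sought is that of the first block not contained in `I`. Such a block has a point
  -- outside `I`, and all of `I` lies below that point, so later blocks of `F` miss `I` and their
  -- intersections with `G` fall into `J`.
  have hex : ∃ p, p = l ∨ p < l ∧ ¬ F p ⊆ I := ⟨l, Or.inl rfl⟩
  classical
  have hp := Nat.find_spec hex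
  have hmin : ∀ {i}, i < Nat.find hex → i ≠ l ∧ (i < l → F i ⊆ I) := fun h => by
    have := Nat.find_min hex h
    push Not at this
    exact this
  set p := Nat.find hex
  have hpl : p ≤ l := by
    rcases hp with h | h
    · exact h.le
    · exact h.1.le
  have hsub : ∀ i < p, F i ⊆ I := fun i hi => (hmin hi).2 (hi.trans_le hpl)
  refine ⟨p, hpl, ?_, ?_⟩
  · intro i
    induction i using Nat.strong_induction_on with
    | _ i ih =>
      intro hi
      have hil : i < l := hi.trans_le hpl
      by_contra hne
      have hnot : ¬ F i ⊆ G i := fun h => hne (Finset.eq_of_subset_of_card_le h (hcard i hil).ge)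
      have hnot' : ¬ G i ⊆ F i := fun h =>
        hne (Finset.eq_of_subset_of_card_le h (hcard i hil).le).symm
      -- At a first disagreement, `x` must lie in a later block of `G`, so `y < x` and `y ∈ I` by
      -- initiality. But no block of `F` can contain `y`.
      obtain ⟨x, hxF, hxG⟩ := Finset.not_subset.1 hnot
      obtain ⟨y, hyG, hyF⟩ := Finset.not_subset.1 hnot'
      have hxI := hsub i hi hxF
      obtain ⟨j, hj, hxj⟩ := mem_initUnion.1 (hIG.1 hxI)
      have hij : i < j := by
        rcases lt_trichotomy i j with h | h | h
        · exact h
        · exact absurd (h ▸ hxj) hxG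
        · rw [← ih j h (h.trans hi)] at hxj
          exact absurd (hF j i h hil x hxj x hxF) (lt_irrefl _)
      have hyx : y < x := hG i j hij hj y hyG x hxj
      have hyI : y ∈ I := by
        by_contra hyI
        exact absurd (hIG.2 x hxI y (Finset.mem_sdiff.2 ⟨mem_initUnion.2 ⟨i, hil, hyG⟩, hyI⟩))
          hyx.asymm
      obtain ⟨k, hk, hyk⟩ := mem_initUnion.1 (hIF.1 hyI)
      rcases lt_trichotomy k i with h | h | h
      · rw [ih k h (h.trans hi)] at hyk
        exact absurd (hG k i h hil y hyk y hyG) (lt_irrefl _)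
      · exact hyF (h ▸ hyk)
      · exact absurd (hF i k h hk x hxF y hyk) hyx.asymm
  · intro i hpi hil
    obtain ⟨z, hz, hzI⟩ := Finset.not_subset.1 (hp.resolve_left (by omega)).2
    have : F i ∩ G i ⊆ J := by
      intro x hx
      rw [Finset.mem_inter] at hx
      have hxIJ : x ∈ I ∪ J := by
        rw [← hIJ]
        exact Finset.mem_inter.2 ⟨mem_initUnion.2 ⟨i, hil, hx.1⟩, mem_initUnion.2 ⟨i, hil, hx.2⟩⟩
      refine (Finset.mem_union.1 hxIJ).resolve_left fun hxI => ?_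
      have h1 := hIF.2 x hxI z
        (Finset.mem_sdiff.2 ⟨mem_initUnion.2 ⟨p, hpi.trans hil, hz⟩, hzI⟩)
      exact absurd (hF p i hpi hil z hz x hx.1) h1.asymm
    have := Finset.card_le_card this
    omega

/-- The left side is at most `2 ^ (-2 * (r ^ 2 - q ^ 2))`, and `r ^ 2 - q ^ 2 = (r - q) * (r + q) ≥
q + r`. -/
theorem half_pow_mul_of_lt {q r x : ℕ} (hqr : q < r) (hx : x ≤ 2 ^ (4 * q ^ 2)) :
    blockWeight q * blockWeight r * x ≤ (1 / 2 : ℝ) ^ q * (1 / 2) ^ r := by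
  have h1 : q + r + 2 * q ^ 2 ≤ 2 * r ^ 2 := by nlinarith
  calc blockWeight q * blockWeight r * x
      ≤ ((2 : ℝ) ^ (2 * q ^ 2))⁻¹ * ((2 : ℝ) ^ (2 * r ^ 2))⁻¹ * 2 ^ (4 * q ^ 2) := by
        unfold blockWeight
        gcongr
        exact_mod_cast hx
    _ = 2 ^ (2 * q ^ 2) * ((2 : ℝ) ^ (2 * r ^ 2))⁻¹ := by
        rw [show 4 * q ^ 2 = 2 * q ^ 2 + 2 * q ^ 2 by ring, pow_add]
        field_simp
    _ ≤ 2 ^ (2 * q ^ 2) * ((2 : ℝ) ^ (q + r + 2 * q ^ 2))⁻¹ := by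
        gcongr
        exact one_le_two
    _ = _ := by
        rw [pow_add, pow_add, one_div, inv_pow, inv_pow]
        field_simp

theorem half_pow_mul_of_ne {q r x : ℕ} (hqr : q ≠ r) (hq : x ≤ 2 ^ (4 * q ^ 2))
    (hr : x ≤ 2 ^ (4 * r ^ 2)) :
    blockWeight q * blockWeight r * x ≤ (1 / 2 : ℝ) ^ q * (1 / 2) ^ r := by
  rcases hqr.lt_or_gt with h | h
  · exact half_pow_mul_of_lt h hq
  · rw [mul_comm (blockWeight q), mul_comm ((1 / 2 : ℝ) ^ q)]
    exact half_pow_mul_of_lt h hr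

theorem blockWeight_mul_self_mul_le {q x k : ℕ} (hx : x ≤ k) :
    blockWeight q * blockWeight q * x ≤ k * (1 / 2 : ℝ) ^ q := by
  rw [blockWeight_mul_self, mul_comm, one_div, inv_pow]
  gcongr
  · exact one_le_two
  · nlinarith [Nat.le_self_pow two_ne_zero q]

/-- The matrix of block pairings is close to the identity truncated at `p`, where the sequences
separate. The errors are at most `1` at `p` and at the last common code `l`, `K * 2 ^ (-q i)`
between them, and summable wherever the codes differ. -/
theorem IsSpecial.exists_pairing_estimate (hF : IsSpecial 𝓑 c m F q) (hG : IsSpecial 𝓑 c m' G r)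
    {K : ℕ} (hc : ∀ s ∈ 𝓑, ∀ t ∈ 𝓑, c s = c t → InDeltaPosition (K : ℤ) s t) :
    ∃ p l, p ≤ m ∧ p ≤ m' ∧ ∀ i < m, ∀ j < m',
      |blockWeight (q i) * blockWeight (r j) * (F i ∩ G j).card -
        if i = j then (if i < p then 1 else 0) else 0| ≤
      (if i = j then (if i = p then 1 else 0) + (if i = l then 1 else 0) + K * (1 / 2 : ℝ) ^ q i
        else 0) + (1 / 2 : ℝ) ^ q i * (1 / 2) ^ r j := by
  have hnn : ∀ i j, 0 ≤ blockWeight (q i) * blockWeight (r j) * ((F i ∩ G j).card : ℝ) := by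
    intro i j
    have := blockWeight_pos (q i)
    have := blockWeight_pos (r j)
    positivity
  have hoff : ∀ i < m, ∀ j < m', q i ≠ r j →
      blockWeight (q i) * blockWeight (r j) * (F i ∩ G j).card ≤
        (1 / 2 : ℝ) ^ q i * (1 / 2) ^ r j := fun i hi j hj h =>
    half_pow_mul_of_ne h
      (hF.card_eq i hi ▸ Finset.card_le_card Finset.inter_subset_left)
      (hG.card_eq j hj ▸ Finset.card_le_card Finset.inter_subset_right)
  have hext : ∀ p l i j, 0 ≤ (if i = j then (if i = p then 1 else 0) + (if i = l then 1 else 0) +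
      K * (1 / 2 : ℝ) ^ q i else 0) := by
    intro p l i j
    split_ifs <;> positivity
  have hdiag : ∀ i < m, blockWeight (q i) * blockWeight (q i) * (F i ∩ G i).card ≤ 1 := by
    intro i hi
    rw [blockWeight_mul_self, inv_mul_le_iff₀ (by positivity), mul_one]
    have := Finset.card_le_card (Finset.inter_subset_left (s₁ := F i) (s₂ := G i))
    rw [hF.card_eq i hi] at this
    exact_mod_cast this
  by_cases hD : ∃ i, i < m ∧ i < m' ∧ q i = r i
  · let D := (Finset.range m).filter fun i => i < m' ∧ q i = r i
    have hDne : D.Nonempty := by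
      obtain ⟨i, h1, h2⟩ := hD
      exact ⟨i, Finset.mem_filter.2 ⟨Finset.mem_range.2 h1, h2⟩⟩
    -- The last common code records all earlier codes and the colour of the union of the earlier
    -- blocks; hence these unions have equal colour and are in `Δ`-position.
    obtain ⟨l, hl, hmax⟩ := D.exists_max_image id hDne
    obtain ⟨hlm, hlm', hql⟩ := Finset.mem_filter.1 hl
    rw [Finset.mem_range] at hlm
    obtain ⟨-, hcl, hqr⟩ := hF.code_eq hG hlm hlm' hql
    have hcard : ∀ i < l, (F i).card = (G i).card := fun i hi => by
      rw [hF.card_eq i (by omega), hG.card_eq i (by omega), hqr i hi]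
    obtain ⟨p, hpl, hpeq, hpK⟩ := exists_agreement_index
      (fun i j hij hj => hF.blockLT i j hij (by omega))
      (fun i j hij hj => hG.blockLT i j hij (by omega)) hcard
      (hc _ (hF.mem l hlm) _ (hG.mem l hlm') hcl)
    refine ⟨p, l, by omega, by omega, fun i hi j hj => ?_⟩
    have hpow : 0 ≤ (1 / 2 : ℝ) ^ q i * (1 / 2) ^ r j := by positivity
    by_cases hqij : q i = r j
    · obtain ⟨rfl, -, -⟩ := hF.code_eq hG hi hj hqij
      have hil : i ≤ l := hmax i (Finset.mem_filter.2 ⟨Finset.mem_range.2 hi, hj, hqij⟩)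
      have h0 := hnn i i
      have h1 := hdiag i hi
      rw [← hqij] at h0 hpow ⊢
      have hK : 0 ≤ K * (1 / 2 : ℝ) ^ q i := by positivity
      simp only [if_true]
      rcases lt_trichotomy i p with hip | hip | hip
      · have hT : blockWeight (q i) * blockWeight (q i) * ((F i ∩ G i).card : ℝ) = 1 := by
          rw [← hpeq i hip, Finset.inter_self, hF.card_eq i hi, blockWeight_mul_self]
          push_cast
          exact inv_mul_cancel₀ (by positivity)
        rw [hT, if_pos hip, sub_self, abs_zero, if_neg hip.ne, if_neg (by omega)]
        linarith
      · rw [if_neg (by omega), sub_zero, abs_of_nonneg h0, if_pos hip]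
        split_ifs <;> linarith
      · rw [if_neg (by omega), sub_zero, abs_of_nonneg h0, if_neg hip.ne']
        rcases hil.eq_or_lt with rfl | hil
        · rw [if_pos rfl]
          linarith
        · have := blockWeight_mul_self_mul_le (q := q i) (hpK i hip hil)
          rw [if_neg hil.ne]
          linarith
    · have hmain : (if i = j then (if i < p then 1 else 0) else 0 : ℝ) = 0 := by
        split_ifs with h1 h2
        · subst h1
          exact absurd (hqr i (by omega)) hqij
        · rfl
        · rfl
      rw [hmain, sub_zero, abs_of_nonneg (hnn i j)]
      linarith [hoff i hi j hj hqij, hext p l i j]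
  · refine ⟨0, 0, Nat.zero_le _, Nat.zero_le _, fun i hi j hj => ?_⟩
    have hqij : q i ≠ r j := by
      intro h
      obtain ⟨rfl, -, -⟩ := hF.code_eq hG hi hj h
      exact hD ⟨i, hi, hj, h⟩
    simp only [Nat.not_lt_zero, if_false, ite_self, sub_zero]
    rw [abs_of_nonneg (hnn i j)]
    linarith [hoff i hi j hj hqij, hext 0 0 i j]

theorem abs_sum_neg_one_pow_le (p : ℕ) : |∑ i ∈ Finset.range p, (-1 : ℝ) ^ i| ≤ 1 := by
  rw [neg_one_geom_sum]
  split_ifs <;> simp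

/-- The constant is `1` for the alternating sum along the agreeing blocks, `2 + 2 * K` for the
diagonal errors, and `2 * 2` for the product of the two geometric sums. -/
theorem IsSpecial.abs_alternating_pairing_le (hF : IsSpecial 𝓑 c m F q)
    (hG : IsSpecial 𝓑 c m' G r) {K : ℕ}
    (hc : ∀ s ∈ 𝓑, ∀ t ∈ 𝓑, c s = c t → InDeltaPosition (K : ℤ) s t) :
    |∑ α ∈ initUnion F m, blockSum (fun i => (-1) ^ i) m F q α * blockSum 1 m' G r α| ≤
      7 + 2 * K := by
  obtain ⟨p, l, hpm, hpm', hT⟩ := hF.exists_pairing_estimate hG hc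
  rw [sum_blockSum_mul_blockSum]
  simp only [Pi.one_apply, mul_one]
  set T : ℕ → ℕ → ℝ := fun i j => blockWeight (q i) * blockWeight (r j) * ((F i ∩ G j).card : ℝ)
  set M : ℕ → ℕ → ℝ := fun i j => if i = j then (if i < p then 1 else 0) else 0
  set g : ℕ → ℝ := fun i =>
    (if i = p then 1 else 0) + (if i = l then 1 else 0) + K * (1 / 2 : ℝ) ^ q i
  have hg : ∀ i, 0 ≤ g i := fun i => by
    simp only [g]
    split_ifs <;> positivity
  have hM : ∑ i ∈ Finset.range m, ∑ j ∈ Finset.range m', (-1) ^ i * M i j =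
      ∑ i ∈ Finset.range p, (-1 : ℝ) ^ i := by
    have h1 : ∀ i, ∑ j ∈ Finset.range m', (-1) ^ i * M i j = if i < p then (-1 : ℝ) ^ i else 0 := by
      intro i
      rw [← Finset.mul_sum, Finset.sum_ite_eq]
      by_cases hi : i < p
      · simp [hi, hi.trans_le hpm']
      · simp [hi]
    simp only [h1]
    rw [← Finset.sum_filter]
    congr 1
    ext i
    simp only [Finset.mem_filter, Finset.mem_range]
    omega
  have hsplit : ∑ i ∈ Finset.range m, ∑ j ∈ Finset.range m', (-1) ^ i * T i j =
      ∑ i ∈ Finset.range p, (-1 : ℝ) ^ i +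
      ∑ i ∈ Finset.range m, ∑ j ∈ Finset.range m', (-1) ^ i * (T i j - M i j) := by
    rw [← hM, ← Finset.sum_add_distrib]
    refine Finset.sum_congr rfl fun i _ => ?_
    rw [← Finset.sum_add_distrib]
    exact Finset.sum_congr rfl fun j _ => by ring
  have hrest : |∑ i ∈ Finset.range m, ∑ j ∈ Finset.range m', (-1) ^ i * (T i j - M i j)| ≤
      ∑ i ∈ Finset.range m, g i +
      (∑ i ∈ Finset.range m, (1 / 2 : ℝ) ^ q i) * ∑ j ∈ Finset.range m', (1 / 2 : ℝ) ^ r j := by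
    rw [Finset.sum_mul_sum, ← Finset.sum_add_distrib]
    refine (Finset.abs_sum_le_sum_abs _ _).trans (Finset.sum_le_sum fun i hi => ?_)
    refine (Finset.abs_sum_le_sum_abs _ _).trans ?_
    calc _ ≤ ∑ j ∈ Finset.range m', ((if i = j then g i else 0) +
          (1 / 2 : ℝ) ^ q i * (1 / 2) ^ r j) := by
          refine Finset.sum_le_sum fun j hj => ?_
          rw [abs_mul, abs_pow, abs_neg, abs_one, one_pow, one_mul]
          exact hT i (Finset.mem_range.1 hi) j (Finset.mem_range.1 hj)
      _ ≤ _ := by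
          rw [Finset.sum_add_distrib, Finset.sum_ite_eq]
          gcongr
          split_ifs
          · exact le_rfl
          · exact hg i
  have hgsum : ∑ i ∈ Finset.range m, g i ≤ 1 + 1 + K * 2 := by
    simp only [g]
    rw [Finset.sum_add_distrib, Finset.sum_add_distrib, Finset.sum_ite_eq', Finset.sum_ite_eq',
      ← Finset.mul_sum]
    gcongr
    · split_ifs <;> norm_num
    · split_ifs <;> norm_num
    · exact sum_half_pow_le_two hF.injOn
  have hprod : (∑ i ∈ Finset.range m, (1 / 2 : ℝ) ^ q i) * ∑ j ∈ Finset.range m', (1 / 2 : ℝ) ^ r j ≤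
      2 * 2 :=
    mul_le_mul (sum_half_pow_le_two hF.injOn) (sum_half_pow_le_two hG.injOn)
      (Finset.sum_nonneg fun _ _ => by positivity) zero_le_two
  rw [hsplit]
  refine (abs_add_le _ _).trans ?_
  linarith [abs_sum_neg_one_pow_le p]

theorem exists_isSpecial {a : ℕ → κ} (ha : StrictMono a)
    (h𝓑 : ∀ s : Finset κ, (s : Set κ) ⊆ Set.range a → s ∈ 𝓑) (c : Finset κ → ℕ) :
    ∃ F q, (∀ m, IsSpecial 𝓑 c m F q) ∧ ∀ i, (F i : Set κ) ⊆ Set.range a := by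
  -- The state of the recursion is the number of terms of `a` already used, with the list of codes
  -- already issued. Blocks are consecutive stretches of `a`, so their union is determined by that
  -- number.
  let code : ℕ × List ℕ → ℕ := fun S => Encodable.encode (c ((Finset.range S.1).image a), S.2)
  let S : ℕ → ℕ × List ℕ := fun i =>
    Nat.rec (0, []) (fun _ S => (S.1 + 2 ^ (4 * code S ^ 2), S.2 ++ [code S])) i
  let q : ℕ → ℕ := fun i => code (S i)
  have hS1 : ∀ i, (S (i + 1)).1 = (S i).1 + 2 ^ (4 * q i ^ 2) := fun _ => rfl
  have hS2 : ∀ i, (S i).2 = (List.range i).map q := by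
    intro i
    induction i with
    | zero => rfl
    | succ i ih =>
      rw [List.range_succ, List.map_append, ← ih]
      rfl
  have hmono : Monotone fun i => (S i).1 := monotone_nat_of_le_succ fun i => by
    change (S i).1 ≤ (S (i + 1)).1
    rw [hS1]
    exact Nat.le_add_right _ _
  let F : ℕ → Finset κ := fun i => (Finset.Ico (S i).1 (S (i + 1)).1).image a
  have hrange : ∀ i, (F i : Set κ) ⊆ Set.range a := by
    intro i x hx
    obtain ⟨k, -, rfl⟩ := Finset.mem_image.1 (Finset.mem_coe.1 hx)
    exact ⟨k, rfl⟩
  have hinit : ∀ i, initUnion F i = (Finset.range (S i).1).image a := by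
    intro i
    induction i with
    | zero => rfl
    | succ i ih =>
      have h1 : initUnion F (i + 1) = F i ∪ initUnion F i := by
        rw [initUnion, Finset.range_add_one, Finset.biUnion_insert]
        rfl
      rw [h1, ih, ← Finset.image_union, Finset.union_comm]
      congr 1
      have := hmono (Nat.le_succ i)
      ext k
      simp only [Finset.mem_union, Finset.mem_range, Finset.mem_Ico, Nat.succ_eq_add_one] at this ⊢
      omega
  refine ⟨F, q, fun m => ⟨?_, ?_, ?_, ?_⟩, hrange⟩
  · intro i j hij _ x hx y hy
    obtain ⟨k, hk, rfl⟩ := Finset.mem_image.1 hx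
    obtain ⟨l, hl, rfl⟩ := Finset.mem_image.1 hy
    have := hmono (show i + 1 ≤ j from hij)
    exact ha ((Finset.mem_Ico.1 hk).2.trans_le (this.trans (Finset.mem_Ico.1 hl).1))
  · intro i _
    rw [Finset.card_image_of_injective _ ha.injective, Nat.card_Ico, hS1, Nat.add_sub_cancel_left]
  · intro i _
    refine h𝓑 _ fun x hx => ?_
    obtain ⟨j, -, hj⟩ := mem_initUnion.1 (Finset.mem_coe.1 hx)
    exact hrange j hj
  · intro i _
    rw [hinit, ← hS2]

end special

/-! ### The conditional weakly null sequence and the conclusion. -/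

/-- Conditional weakly null sequences from a very-large family with a countable colouring. -/
theorem exists_weaklyNull_of_veryLarge {κ : Type} [LinearOrder κ] [WellFoundedLT κ]
    {𝓑 : Set (Finset κ)} (h𝓑 : IsVeryLarge 𝓑) {c : Finset κ → ℕ} {K : ℕ}
    (hc : ∀ s ∈ 𝓑, ∀ t ∈ 𝓑, c s = c t → InDeltaPosition (K : ℤ) s t) :
    ∃ (X : Type) (_ : NormedAddCommGroup X) (_ : NormedSpace ℝ X) (_ : CompleteSpace X)
      (x : κ → X), (∀ α, ‖x α‖ = 1) ∧ IsWeaklyNull x ∧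
      ∀ A : Set κ, A.Infinite → ¬ IsUnconditionalBasicSequence (fun α : A => x α) := by
  classical
  have hsign : ∀ i : ℕ, |(-1 : ℝ) ^ i| ≤ 1 := fun i => by simp
  refine exists_weaklyNull_of_functionals
    -- The coordinate functionals make the vectors have norm one, which the block weights alone need
    -- not give.
    (Set.range (fun β : κ => (Pi.single β 1 : κ → ℝ)) ∪
      {w | ∃ m F q, IsSpecial 𝓑 c m F q ∧ w = blockSum 1 m F q})
    ?_ ?_ (C := 7 + 2 * K) (by positivity) ?_ ?_
  · rintro w (⟨β, rfl⟩ | ⟨m, F, q, hF, rfl⟩) α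
    · by_cases h : α = β <;> simp [h]
    · exact hF.abs_blockSum_le (by simp) α
  · exact fun α => ⟨_, Or.inl ⟨α, rfl⟩, by simp⟩
  · rintro w (⟨β, rfl⟩ | ⟨k, F, q, hF, rfl⟩) m H hH
    · have h1 : |∑ α ∈ H, (Pi.single β 1 : κ → ℝ) α| ≤ m ^ 3 := by
        rcases m.eq_zero_or_pos with rfl | hm
        · obtain rfl : H = ∅ := by simpa using hH
          simp
        · have h2 : (1 : ℝ) ≤ m ^ 3 := one_le_pow₀ (by exact_mod_cast hm)
          refine le_trans ?_ h2
          simp only [Pi.single_apply, Finset.sum_ite_eq']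
          split_ifs <;> simp
      refine h1.trans (le_mul_of_one_le_left (by positivity) ?_)
      have : (0 : ℝ) ≤ K := by positivity
      linarith
    · refine (hF.abs_sum_le hH).trans (mul_le_mul_of_nonneg_right ?_ (by positivity))
      have : (0 : ℝ) ≤ K := by positivity
      linarith
  · intro A hA m
    obtain ⟨B, hBA, hB, hB𝓑⟩ := h𝓑 A hA
    obtain ⟨a, ha, haB⟩ := exists_strictMono_mem_of_infinite hB
    have hra : Set.range a ⊆ B := by
      rintro _ ⟨i, rfl⟩
      exact haB i
    obtain ⟨F, q, hF, hFa⟩ := exists_isSpecial ha (fun s hs => hB𝓑 s (hs.trans hra)) c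
    refine ⟨initUnion F m, fun x hx => ?_, blockSum 1 m F q, blockSum (fun i => (-1) ^ i) m F q,
      fun α hα => ?_, ⟨_, Or.inr ⟨m, F, q, hF m, rfl⟩, ?_⟩, ?_⟩
    · obtain ⟨j, -, hj⟩ := mem_initUnion.1 (Finset.mem_coe.1 hx)
      exact hBA (hra (hFa j hj))
    · obtain ⟨i, hi, hα⟩ := mem_initUnion.1 hα
      rw [(hF m).blockSum_eq _ hi hα, (hF m).blockSum_eq _ hi hα]
      rcases neg_one_pow_eq_or ℝ i with h | h
      · left
        simp [h]
      · right
        simp [h]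
    · exact (hF m).le_sum_mul_self.trans (le_abs_self _)
    · rintro w (⟨β, rfl⟩ | ⟨k, G, r, hG, rfl⟩)
      · have h1 : |∑ α ∈ initUnion F m, blockSum (fun i => (-1) ^ i) m F q α *
            (Pi.single β 1 : κ → ℝ) α| ≤ 1 := by
          simp only [Pi.single_apply, mul_ite, mul_one, mul_zero, Finset.sum_ite_eq']
          split_ifs
          · exact (hF m).abs_blockSum_le hsign β
          · simp
        have : (0 : ℝ) ≤ K := by positivity
        linarith
      · exact (hF m).abs_alternating_pairing_le hG hc

theorem mainTheorem2 (n : ℕ) :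
    (∃ 𝓑 : Set (Finset (ω_ (n : Ordinal.{0})).ToType),
      IsVeryLarge 𝓑 ∧ chromaticCardinal (positionalGraphOn (2 * (n : ℤ) - 1) 𝓑) = ℵ₀) ∧
    (∃ (X : Type) (_ : NormedAddCommGroup X) (_ : NormedSpace ℝ X) (_ : CompleteSpace X)
      (x : (ω_ (n : Ordinal.{0})).ToType → X),
      (∀ α, ‖x α‖ = 1) ∧ IsWeaklyNull x ∧
      ∀ A : Set (ω_ (n : Ordinal.{0})).ToType, A.Infinite →
        ¬ IsUnconditionalBasicSequence (fun α : A => x α)) := by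
  refine ⟨exists_veryLarge_chromaticCardinal n, ?_⟩
  obtain ⟨𝓑, h𝓑, c, hc⟩ := exists_veryLarge_coloring n
  -- The value `2 * n` is used instead of `2 * n - 1` because `K` is a natural number, and because a
  -- set must be in position with itself even when `n = 0`.
  refine exists_weaklyNull_of_veryLarge h𝓑 (c := c) (K := 2 * n) fun s hs t ht hst => ?_
  by_cases hne : s = t
  · subst hne
    exact ⟨s, ∅, by simp [BlockLT], by simp, by simp, ⟨subset_rfl, by simp [BlockLT]⟩,
      subset_rfl, by simp [BlockLT]⟩
  · obtain ⟨I, J, h1, h2, h3, h4, h5⟩ := hc s hs t ht hst hne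
    exact ⟨I, J, h1, h2, by push_cast; omega, h4, h5⟩
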